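/- **Setting.** A tabular MDP $\mathcal M=(\mathcal S,\mathcal A,H,P_0,\{P_h\}_{h=1}^H,\{R_h\}_{h=1}^H)$ has $S$ states, $A$ actions, horizon $H$, initial distribution $P_0$, transition kernels $P_h(\cdot\mid s,a)$ and reward distributions $R_h(s,a)$ on $[0,1]$. A policy $\pi=(\pi_h(a\mid s))$ is Markov and possibly stochastic. $V^\pi_h,Q^\pi_h$ are its value functions, $V^\pi_0=\sum_s P_0(s)V^\pi_1(s)$, and $V^\star_h=\sup_\pi V^\pi_h$, $Q^\star_h=\sup_\pi Q^\pi_h$, $V_0^\star=\sup_\pi V_0^\pi$. Put $\Delta_h(s,a)=V^\star_h(s)-Q^\star_h(s,a)$, $w^\pi_h(s,a)=\Pr_\pi[s_h=s,a_h=a]$, $W_h(s)=\sup_\pi\Pr_\pi[s_h=s]$, and $$C^\star(\mathcal M)=\sum_{h=1}^H C_h(\mathcal M),\qquad C_h(\mathcal M)=\inf_\pi\ \max_{s,a\,:\,\Delta_h(s,a)>0}\ \frac1{w^\pi_h(s,a)\,\Delta_h(s,a)^2}\qquad(1/0=\infty).$$ An algorithm plays, in each episode, a policy chosen from the data of the past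 episodes and internal randomness; it observes the episode (states, actions, rewards), and stops after a random number $K_\delta$ of episodes (a stopping time) with an output policy $\widehat\pi$. It is $(0,\delta)$-PAC if, on every MDP with $S$ states, $A$ actions and horizon $H$ that has a unique optimal action at every $(s,h)$ and satisfies $W_h(s)>0$ for all $s,h$, with probability at least $1-\delta$ it stops and $V_0^{\widehat\pi}=V_0^\star$. **Proposition.** There is an absolute constant $c>0$ such that the following holds. Let $S,A,H>1$, let $\hbar\in\{1,\dots,H\}$, and fix an initial distribution $P_0$, transition kernels $\{P_h\}_{h=1}^{\hbar-1}$, an action $a^\star(s)$ for every state $s$, and numbers $\mathsf{gap}(s,a)\in(0,1/2)$ for all $s$ and all $a\ne a^\star(s)$. Then there is an MDP $\mathcal M$ with $S$ states, $A$ actions, horizon $H$, initial distribution $P_0$, transition kernels $P_h$ for $h\le\hbar-1$, and a unique optimal action $\pi^\star_h(s)$ at every $(s,h)$, with $\pi^\star_{\hbar}(s)=a^\star(s)$, such that $$\Delta_{\hbar}(s,a)=\mathsf{gap}(s,a)\ \ \forall s,\ a\neq\pi^\star_{\hbar}(s),\qquad \Delta_h(s,a)\ge 1\ \ \forall s,\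 h\ne\hbar,\ a\ne\pi^\star_h(s),$$ and for every $\delta\in(0,1)$ every $(0,\delta)$-PAC algorithm satisfies, if $\delta<1/2.4$, $$\mathbb E_{\mathcal M}[K_\delta]\ \ge\ c\cdot\inf_\pi\max_{s,\,a\ne\pi^\star_{\hbar}(s)}\frac{1}{w^\pi_{\hbar}(s,a)\,\Delta_{\hbar}(s,a)^2}\cdot\log_2\frac1{2.4\,\delta}$$ (for $\delta\ge 1/2.4$ the right-hand side is read as $0$; both sides may be infinite). Moreover, on this MDP $$C^\star(\mathcal M)\ \le\ \inf_\pi\max_{s,\,a\ne\pi^\star_{\hbar}(s)}\frac{1}{w^\pi_{\hbar}(s,a)\,\Delta_{\hbar}(s,a)^2}+SAH\cdot\max_{s,\,h\le\hbar}\frac1{W_h(s)},$$ so that the lower bound matches $C^\star(\mathcal M)\log\frac1\delta$ up to this reachability term. -/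

import Mathlib

open MeasureTheory ProbabilityTheory
open scoped ENNReal

noncomputable section

namespace TabularRL

/-! Finite-horizon, time-inhomogeneous tabular MDPs with `S` states, `A` actions and horizon `H`.
The steps `1, …, H` are indexed by `Fin H`, that is, by `0, …, H - 1`. -/

/-- A Markov decision process: initial distribution, transition kernels, and reward
distributions supported on `[0,1]`. -/
structure MDP (S A H : ℕ) where
  /-- initial state distribution -/
  P0 : stdSimplex ℝ (Fin S)
  /-- transition kernels: `P h s a s'` is the probability of moving from `s` to `s'` -/
  P : Fin H → Fin S → Fin A → stdSimplex ℝ (Fin S)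
  /-- reward distributions -/
  R : Fin H → Fin S → Fin A → ProbabilityMeasure unitInterval

/-- A (possibly stochastic) Markov policy: `π h s a` is the probability of playing `a`
in state `s` at step `h`. -/
abbrev Policy (S A H : ℕ) : Type := Fin H → Fin S → stdSimplex ℝ (Fin A)

/-- An episode: the state, the action and the reward at every step. -/
abbrev Episode (S A H : ℕ) : Type := Fin H → Fin S × Fin A × unitInterval

namespace MDP

variable {S A H : ℕ}

/-- The probability, given the past, of the state at step `h` of the state-action path `p`. -/
def stateProb (P0 : stdSimplex ℝ (Fin S)) (P : Fin H → Fin S → Fin A → stdSimplex ℝ (Fin S))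
    (p : Fin H → Fin S × Fin A) (h : Fin H) : ℝ :=
  if h.val = 0 then P0 (p h).1
  else
    let g : Fin H := ⟨h.val - 1, lt_of_le_of_lt (Nat.sub_le _ _) h.isLt⟩
    P g (p g).1 (p g).2 (p h).1

/-- The probability that the states and actions of an episode are those of the path `p`. -/
def pathProb (P0 : stdSimplex ℝ (Fin S)) (P : Fin H → Fin S → Fin A → stdSimplex ℝ (Fin S))
    (π : Policy S A H) (p : Fin H → Fin S × Fin A) : ℝ :=
  ∏ h, stateProb P0 P p h * π h (p h).1 (p h).2

theorem pathProb_nonneg (P0 : stdSimplex ℝ (Fin S))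
    (P : Fin H → Fin S → Fin A → stdSimplex ℝ (Fin S)) (π : Policy S A H)
    (p : Fin H → Fin S × Fin A) : 0 ≤ pathProb P0 P π p := by
  refine Finset.prod_nonneg fun h _ => mul_nonneg ?_ ((π h (p h).1).2.1 _)
  unfold stateProb
  split_ifs
  · exact P0.2.1 _
  · exact (P _ _ _).2.1 _

theorem pathProb_cons (P0 : stdSimplex ℝ (Fin S))
    (P : Fin (H + 1) → Fin S → Fin A → stdSimplex ℝ (Fin S)) (π : Policy S A (H + 1))
    (x : Fin S × Fin A) (p : Fin H → Fin S × Fin A) :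
    pathProb P0 P π (Fin.cons x p : Fin (H + 1) → Fin S × Fin A) =
      P0 x.1 * π 0 x.1 x.2 *
        pathProb (P 0 x.1 x.2) (fun h => P h.succ) (fun h => π h.succ) p := by
  unfold pathProb
  rw [Fin.prod_univ_succ]
  congr 1
  refine Finset.prod_congr rfl fun h _ => ?_
  congr 1
  rcases h with ⟨_ | n, hn⟩
  · simp only [stateProb, Fin.val_succ, Nat.succ_ne_zero, if_false, if_true]
    rfl
  · simp only [stateProb, Fin.val_succ, Nat.succ_ne_zero, if_false]
    rfl

theorem sum_pathProb (P0 : stdSimplex ℝ (Fin S))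
    (P : Fin H → Fin S → Fin A → stdSimplex ℝ (Fin S)) (π : Policy S A H) :
    ∑ p, pathProb P0 P π p = 1 := by
  induction H generalizing P0 with
  | zero => simp [pathProb]
  | succ n ih =>
    rw [← (Fin.consEquiv (fun _ : Fin (n + 1) => Fin S × Fin A)).sum_comp, Fintype.sum_prod_type]
    have key : ∀ x : Fin S × Fin A, ∑ p : Fin n → Fin S × Fin A,
        pathProb P0 P π (Fin.consEquiv (fun _ : Fin (n + 1) => Fin S × Fin A) (x, p)) =
          P0 x.1 * π 0 x.1 x.2 := by
      intro x
      have h1 : ∀ p : Fin n → Fin S × Fin A,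
          pathProb P0 P π (Fin.consEquiv (fun _ : Fin (n + 1) => Fin S × Fin A) (x, p)) =
          P0 x.1 * π 0 x.1 x.2 *
            pathProb (P 0 x.1 x.2) (fun h => P h.succ) (fun h => π h.succ) p :=
        fun p => pathProb_cons P0 P π x p
      simp_rw [h1]
      rw [← Finset.mul_sum, ih, mul_one]
    simp_rw [key]
    rw [Fintype.sum_prod_type]
    simp_rw [← Finset.mul_sum]
    have h2 : ∀ s, ∑ a, π 0 s a = 1 := fun s => (π 0 s).2.2
    simp_rw [h2, mul_one]
    exact P0.2.2

/-- The law of an episode under policy `π`: the states and actions form a Markov chain with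
`s₁ ∼ P₀`, `aₕ ∼ πₕ(· | sₕ)`, `sₕ₊₁ ∼ Pₕ(· | sₕ, aₕ)`, and given these the rewards are independent
with `Rₕ ∼ Rₕ(sₕ, aₕ)`. -/
def episodeLaw (M : MDP S A H) (π : Policy S A H) : Measure (Episode S A H) :=
  ∑ p : Fin H → Fin S × Fin A, ENNReal.ofReal (pathProb M.P0 M.P π p) •
    (Measure.pi fun h => (M.R h (p h).1 (p h).2 : Measure unitInterval)).map
      fun r h => ((p h).1, (p h).2, r h)

instance (M : MDP S A H) (π : Policy S A H) : IsProbabilityMeasure (M.episodeLaw π) := by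
  constructor
  unfold episodeLaw
  rw [Measure.finsetSum_apply]
  have h : ∀ p : Fin H → Fin S × Fin A, (ENNReal.ofReal (pathProb M.P0 M.P π p) •
      (Measure.pi fun h => (M.R h (p h).1 (p h).2 : Measure unitInterval)).map
        fun r h => ((p h).1, (p h).2, r h)) Set.univ = ENNReal.ofReal (pathProb M.P0 M.P π p) := by
    intro p
    rw [Measure.smul_apply, Measure.map_apply (by fun_prop) MeasurableSet.univ]
    simp
  simp_rw [h]
  rw [← ENNReal.ofReal_sum_of_nonneg fun p _ => pathProb_nonneg _ _ _ p, sum_pathProb]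
  simp

theorem measurable_pathProb (P0 : stdSimplex ℝ (Fin S))
    (P : Fin H → Fin S → Fin A → stdSimplex ℝ (Fin S)) (p : Fin H → Fin S × Fin A) :
    Measurable fun π : Policy S A H => pathProb P0 P π p := by
  unfold pathProb
  refine Finset.measurable_prod _ fun h _ => Measurable.const_mul ?_ _
  exact (measurable_pi_apply _).comp (measurable_subtype_coe.comp
    ((measurable_pi_apply _).comp (measurable_pi_apply h)))

/-- The law of an episode, as a Markov kernel from policies to episodes. -/
def episodeKernel (M : MDP S A H) : Kernel (Policy S A H) (Episode S A H) where
  toFun := M.episodeLaw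
  measurable' := by
    refine Measure.measurable_of_measurable_coe _ fun B _ => ?_
    unfold episodeLaw
    simp_rw [Measure.finsetSum_apply, Measure.smul_apply]
    exact Finset.measurable_sum _ fun p _ =>
      (measurable_pathProb _ _ p).ennreal_ofReal.mul_const _

instance (M : MDP S A H) : IsMarkovKernel M.episodeKernel :=
  ⟨fun π => inferInstanceAs (IsProbabilityMeasure (M.episodeLaw π))⟩

/-- Mean reward `rₕ(s,a)`. -/
def meanReward (M : MDP S A H) (h : Fin H) (s : Fin S) (a : Fin A) : ℝ :=
  ∫ x, (x : ℝ) ∂(M.R h s a : Measure unitInterval)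

/-- The value function of the policy `π`, by the Bellman recursion; it is `0` after the last
step. -/
def V (M : MDP S A H) (π : Policy S A H) (h : ℕ) (s : Fin S) : ℝ :=
  if hh : h < H then
    ∑ a, π ⟨h, hh⟩ s a * (M.meanReward ⟨h, hh⟩ s a + ∑ s', M.P ⟨h, hh⟩ s a s' * V M π (h + 1) s')
  else 0
termination_by H - h

/-- The `Q`-value function of the policy `π`. -/
def Q (M : MDP S A H) (π : Policy S A H) (h : Fin H) (s : Fin S) (a : Fin A) : ℝ :=
  M.meanReward h s a + ∑ s', M.P h s a s' * M.V π (h.val + 1) s'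

/-- The value `V₀^π` of a policy: its expected total reward. -/
def value (M : MDP S A H) (π : Policy S A H) : ℝ := ∑ s, M.P0 s * M.V π 0 s

/-- The optimal `Q`-function. -/
def Qstar (M : MDP S A H) (h : Fin H) (s : Fin S) (a : Fin A) : ℝ := ⨆ π, M.Q π h s a

/-- The optimal value function. -/
def Vstar (M : MDP S A H) (h : Fin H) (s : Fin S) : ℝ := ⨆ π, M.V π h.val s

/-- The optimal value `V₀^⋆`. -/
def optValue (M : MDP S A H) : ℝ := ⨆ π, M.value π

/-- The suboptimality gap `Δₕ(s,a) = Vₕ^⋆(s) - Qₕ^⋆(s,a)`. -/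
def gap (M : MDP S A H) (h : Fin H) (s : Fin S) (a : Fin A) : ℝ := M.Vstar h s - M.Qstar h s a

/-- Every `(s,h)` has a unique optimal action. -/
def HasUniqueOptimalActions (M : MDP S A H) : Prop := ∀ h s, ∃! a, M.gap h s a = 0

/-- The visitation probability `wₕ^π(s,a)`. -/
def visit (M : MDP S A H) (π : Policy S A H) (h : Fin H) (s : Fin S) (a : Fin A) : ℝ≥0∞ :=
  M.episodeLaw π {e | (e h).1 = s ∧ (e h).2.1 = a}

/-- The visitation probability `wₕ^π(s)`. -/
def visitState (M : MDP S A H) (π : Policy S A H) (h : Fin H) (s : Fin S) : ℝ≥0∞ :=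
  M.episodeLaw π {e | (e h).1 = s}

/-- The maximum reachability `Wₕ(s)`. -/
def reach (M : MDP S A H) (h : Fin H) (s : Fin S) : ℝ≥0∞ := ⨆ π, M.visitState π h s

/-- `inf_π max_{s,a} 1 / (wₕ^π(s,a) Δₕ(s,a)²)`, where the maximum is over the suboptimal actions
and `1/0 = ∞`. -/
def levelComplexity (M : MDP S A H) (h : Fin H) : ℝ≥0∞ :=
  ⨅ π : Policy S A H, ⨆ (s : Fin S) (a : Fin A) (_ : 0 < M.gap h s a),
    (M.visit π h s a * ENNReal.ofReal (M.gap h s a ^ 2))⁻¹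

/-- The best-policy gap-visitation complexity `C⋆(M)`. -/
def bestPolicyComplexity (M : MDP S A H) : ℝ≥0∞ := ∑ h, M.levelComplexity h

end MDP

/-- What an algorithm knows when it has completed `k` episodes: the random numbers and the
episodes of the first `k` rounds, and a fresh random number. -/
abbrev Info (S A H k : ℕ) : Type := (Fin k → unitInterval × Episode S A H) × unitInterval

/-- A (randomized) algorithm for policy identification. In each round it draws a fresh uniform
random number; using everything it has seen, it decides whether to stop and output a policy or to
play some policy for one more episode. -/
structure Algorithm (S A H : ℕ) where
  /-- the policy played for the next episode, after `k` episodes -/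
  play : (k : ℕ) → Info S A H k → Policy S A H
  measurable_play : ∀ k, Measurable (play k)
  /-- the event that the algorithm stops after `k` episodes -/
  halt : (k : ℕ) → Set (Info S A H k)
  measurableSet_halt : ∀ k, MeasurableSet (halt k)
  /-- the policy returned if the algorithm stops after `k` episodes -/
  output : (k : ℕ) → Info S A H k → Policy S A H
  measurable_output : ∀ k, Measurable (output k)

namespace Algorithm

variable {S A H : ℕ}

/-- The conditional law of round `k` (random number and episode) given the previous rounds. -/
def roundKernel (alg : Algorithm S A H) (M : MDP S A H) (k : ℕ) :
    Kernel (Fin k → unitInterval × Episode S A H) (unitInterval × Episode S A H) :=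
  Kernel.const _ (volume : Measure unitInterval) ⊗ₖ M.episodeKernel.comap (alg.play k) (alg.measurable_play k)

instance (alg : Algorithm S A H) (M : MDP S A H) (k : ℕ) :
    IsMarkovKernel (alg.roundKernel M k) := by
  unfold roundKernel
  infer_instance

/-- The law on infinite sequences of rounds generated by the algorithm interacting with `M`
(continued after the algorithm stops, which affects neither stopping time nor output). -/
def law (alg : Algorithm S A H) (M : MDP S A H) : Measure (ℕ → unitInterval × Episode S A H) :=
  Kernel.trajMeasure (X := fun _ => unitInterval × Episode S A H) (alg.roundKernel M 0 Fin.elim0)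
    fun n => (alg.roundKernel M (n + 1)).comap
      (fun x (i : Fin (n + 1)) => x ⟨i.val, Finset.mem_Iic.2 (Nat.le_of_lt_succ i.isLt)⟩)
      (by fun_prop)

/-- The information available after `k` rounds. -/
def info (k : ℕ) (ω : ℕ → unitInterval × Episode S A H) : Info S A H k := (fun i => ω i.val, (ω k).1)

/-- The stopping time: the number of episodes after which the algorithm stops. -/
def stopTime (alg : Algorithm S A H) (ω : ℕ → unitInterval × Episode S A H) : ℕ∞ :=
  ⨅ (k : ℕ) (_ : info k ω ∈ alg.halt k), (k : ℕ∞)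

/-- The expected number of episodes. -/
def expectedEpisodes (alg : Algorithm S A H) (M : MDP S A H) : ℝ≥0∞ :=
  ∫⁻ ω, (alg.stopTime ω : ℝ≥0∞) ∂(alg.law M)

/-- On every MDP of the class `𝔐`, with probability at least `1 - δ`, the algorithm stops and
returns an `ε`-optimal policy. -/
def IsPAC (alg : Algorithm S A H) (𝔐 : Set (MDP S A H)) (ε δ : ℝ) : Prop :=
  ∀ M ∈ 𝔐, ENNReal.ofReal (1 - δ) ≤ alg.law M
    {ω | ∃ k : ℕ, alg.stopTime ω = k ∧ M.optValue - M.value (alg.output k (info k ω)) ≤ ε}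

end Algorithm

/-- The MDPs with unique optimal actions in which every state can be reached at every step:
those on which exact identification of an optimal policy is possible. -/
def identifiable (S A H : ℕ) : Set (MDP S A H) :=
  {M | M.HasUniqueOptimalActions ∧ ∀ h s, 0 < M.reach h s}

end TabularRL

end

/-! The instance keeps the given transitions before `hbar`, moves uniformly from `hbar` on, and has
Bernoulli rewards: means 1 (one action) and 0 (the others) away from `hbar`, and 1/2 against 1/2 -
gap at `hbar`. The best mean reward at a step does not depend on the state, so the optimal value
functions are constant in the state whatever the transitions are, and every gap is a difference of
mean rewards (`IsLeveled.exists_V_mem`, `IsLeveled.gap_hbar`, `IsLeveled.le_gap`).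

Lower bound: raising the mean of a suboptimal pair (s, b) at `hbar` to 1/2 + gap/2 makes b optimal
there, and each visit to the pair contributes a divergence of at most 12 gap². A correct algorithm
must answer differently in the two situations, so a change of measure at the stopping time
(`Algorithm.le_mul_tsum_visits`) bounds gap² times the expected number of visits from below by a
multiple of log(1/δ). These expected numbers are integrals of visitation probabilities against the
occupation measure of the played policies, whose mass is at most the expected number of episodes.
The normalized mixture has the visitation probabilities of a single Markov policy
(`MDP.exists_policy_visit_eq_lintegral`), a candidate in the infimum defining `levelComplexity`;
this gives `levelComplexity_mul_log_le`.

The obstacle is that correctness is only assumed where every state is reachable, which the given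
`P0` and `P` need not allow, so neither the instance nor its perturbation need belong to the class.
Mixing the transitions with a little of the uniform distribution produces members of the class whose
episode law dominates c times the original one with c close to 1. Over a fixed number n of rounds
this costs a factor c^n, and c tends to 1 before n grows
(`Algorithm.sum_lintegral_stopSet_inter_le`, `sum_lintegral_mistake_le`).

Upper bound on the complexity: away from `hbar` the gaps are at least 1, so only visitation matters.
Before `hbar` a mixture of nearly best explorers of each state suffices; after `hbar` the uniform
policy visits every pair with probability 1/(SA) (`bestPolicyComplexity_le`). -/

namespace TabularRL

/-! ### The law of the interaction and change of measure over finitely many rounds -/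

namespace Algorithm

variable {S A H : ℕ}

/-- The first `k` rounds. -/
def rounds (k : ℕ) (ω : ℕ → unitInterval × Episode S A H) :
    Fin k → unitInterval × Episode S A H := fun i => ω i

/-- Append a round to a list of rounds. -/
def append {k : ℕ} (y : Fin k → unitInterval × Episode S A H)
    (x : unitInterval × Episode S A H) : Fin (k + 1) → unitInterval × Episode S A H :=
  fun i => if h : i.val < k then y ⟨i, h⟩ else x

@[fun_prop]
theorem measurable_rounds (k : ℕ) : Measurable (rounds (S := S) (A := A) (H := H) k) := by
  unfold rounds; fun_prop

@[fun_prop]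
theorem measurable_info (k : ℕ) : Measurable (info (S := S) (A := A) (H := H) k) := by
  unfold info; fun_prop

@[fun_prop]
theorem measurable_append (k : ℕ) : Measurable fun p : (Fin k → unitInterval × Episode S A H) ×
    (unitInterval × Episode S A H) => append p.1 p.2 := by
  refine measurable_pi_lambda _ fun i => ?_
  unfold append
  by_cases h : i.val < k
  · simp only [h, dite_true]; fun_prop
  · simp only [h, dite_false]; fun_prop

theorem append_rounds (k : ℕ) (ω : ℕ → unitInterval × Episode S A H) :
    append (rounds k ω) (ω k) = rounds (k + 1) ω := by
  funext i
  unfold append rounds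
  split_ifs with h
  · rfl
  · have : i.val = k := by omega
    rw [this]

instance (alg : Algorithm S A H) (M : MDP S A H) : IsProbabilityMeasure (alg.law M) := by
  unfold law; infer_instance

theorem map_law_zero (alg : Algorithm S A H) (M : MDP S A H) :
    (alg.law M).map (fun ω => ω 0) = alg.roundKernel M 0 Fin.elim0 := by
  unfold law Kernel.trajMeasure
  rw [Measure.map_comp _ _ (by fun_prop)]
  have : (fun ω : ℕ → unitInterval × Episode S A H => ω 0) =
      (fun x : (i : Finset.Iic 0) → unitInterval × Episode S A H =>
        x ⟨0, Finset.mem_Iic.2 le_rfl⟩) ∘ Preorder.frestrictLe 0 := rfl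
  rw [this, Kernel.map_comp_right _ (Preorder.measurable_frestrictLe 0) (by fun_prop), Kernel.traj_map_frestrictLe,
    Kernel.partialTraj_self, ← Measure.map_comp _ _ (by fun_prop), Measure.id_comp,
    Measure.map_map (by fun_prop) (by fun_prop)]
  exact Measure.map_id

/-- All later computations use the trajectory measure only through this one-step disintegration. The
trajectory measure treats its initial law separately and indexes histories by `Finset.Iic n`, hence
the case split and the reindexing. -/
theorem map_law_step (alg : Algorithm S A H) (M : MDP S A H) (k : ℕ) :
    (alg.law M).map (fun ω => (rounds k ω, ω k)) =
      (alg.law M).map (rounds k) ⊗ₘ alg.roundKernel M k := by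
  cases k with
  | zero =>
    have h1 : (fun ω : ℕ → unitInterval × Episode S A H => (rounds 0 ω, ω 0)) =
        (fun x => ((Fin.elim0 : Fin 0 → unitInterval × Episode S A H), x)) ∘ fun ω => ω 0 := by
      funext ω; simp only [Function.comp, Prod.mk.injEq, and_true]; exact Subsingleton.elim _ _
    have h2 : (rounds 0 : (ℕ → unitInterval × Episode S A H) → _) = fun _ => Fin.elim0 := by
      funext ω; exact Subsingleton.elim _ _
    rw [h1, ← Measure.map_map (by fun_prop) (by fun_prop), map_law_zero, h2, Measure.map_const,
      measure_univ, one_smul]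
    ext s hs
    rw [Measure.dirac_compProd_apply hs, Measure.map_apply (by fun_prop) hs]
  | succ n =>
    have hf : Measurable (fun (x : (i : Finset.Iic n) → unitInterval × Episode S A H)
        (i : Fin (n + 1)) => x ⟨i.val, Finset.mem_Iic.2 (Nat.le_of_lt_succ i.isLt)⟩) := by fun_prop
    have key := Kernel.map_frestrictLe_trajMeasure_compProd_eq_map_trajMeasure
      (X := fun _ => unitInterval × Episode S A H) (μ₀ := alg.roundKernel M 0 Fin.elim0)
      (κ := fun n => (alg.roundKernel M (n + 1)).comap _ (by fun_prop :
        Measurable (fun (x : (i : Finset.Iic n) → unitInterval × Episode S A H)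
        (i : Fin (n + 1)) => x ⟨i.val, Finset.mem_Iic.2 (Nat.le_of_lt_succ i.isLt)⟩)))
        (a := n)
    have key2 := congrArg (Measure.map (Prod.map (fun (x : (i : Finset.Iic n) → unitInterval × Episode S A H)
        (i : Fin (n + 1)) => x ⟨i.val, Finset.mem_Iic.2 (Nat.le_of_lt_succ i.isLt)⟩) id)) key
    rw [Measure.map_map (by fun_prop) (by fun_prop)] at key2
    refine key2.symm.trans ?_
    ext s hs
    rw [Measure.map_apply (by fun_prop) hs, Measure.compProd_apply (by measurability),
      Measure.compProd_apply hs, lintegral_map (Kernel.measurable_kernel_prodMk_left hs) (by fun_prop),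
      lintegral_map (Kernel.measurable_kernel_prodMk_left (by measurability)) (by fun_prop)]
    rfl

theorem lintegral_law_round (alg : Algorithm S A H) (M : MDP S A H) (k : ℕ)
    {f : (Fin k → unitInterval × Episode S A H) × (unitInterval × Episode S A H) → ℝ≥0∞}
    (hf : Measurable f) :
    ∫⁻ ω, f (rounds k ω, ω k) ∂alg.law M =
      ∫⁻ ω, ∫⁻ u, ∫⁻ e, f (rounds k ω, (u, e)) ∂M.episodeLaw (alg.play k (rounds k ω, u))
        ∂(volume : Measure unitInterval) ∂alg.law M := by
  rw [← lintegral_map (μ := alg.law M) (g := fun ω => (rounds k ω, ω k)) hf (by fun_prop),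
    map_law_step, Measure.lintegral_compProd hf, lintegral_map _ (by fun_prop)]
  · refine lintegral_congr fun ω => ?_
    unfold roundKernel
    rw [Kernel.lintegral_compProd _ _ _ (by fun_prop)]
    rfl
  · exact Measurable.lintegral_kernel_prod_right' hf

/-- Before round `k` is played, its random number is uniform and independent of the past. -/
theorem lintegral_law_info (alg : Algorithm S A H) (M : MDP S A H) (k : ℕ)
    {f : Info S A H k → ℝ≥0∞} (hf : Measurable f) :
    ∫⁻ ω, f (info k ω) ∂alg.law M =
      ∫⁻ ω, ∫⁻ u, f (rounds k ω, u) ∂(volume : Measure unitInterval) ∂alg.law M := by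
  have := lintegral_law_round alg M k (f := fun p => f (p.1, p.2.1)) (by fun_prop)
  simp only [lintegral_const, measure_univ, mul_one] at this
  exact this

theorem lintegral_law_info_episode (alg : Algorithm S A H) (M : MDP S A H) (k : ℕ)
    {f : Info S A H k × Episode S A H → ℝ≥0∞} (hf : Measurable f) :
    ∫⁻ ω, f (info k ω, (ω k).2) ∂alg.law M =
      ∫⁻ ω, ∫⁻ e, f (info k ω, e) ∂M.episodeLaw (alg.play k (info k ω)) ∂alg.law M := by
  have h1 := lintegral_law_round alg M k (f := fun p => f ((p.1, p.2.1), p.2.2)) (by fun_prop)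
  refine h1.trans (lintegral_law_info alg M k
    (f := fun x => ∫⁻ e, f (x, e) ∂M.episodeLaw (alg.play k x)) ?_).symm
  exact Measurable.lintegral_kernel_prod_right' (κ := M.episodeKernel.comap _ (alg.measurable_play k)) hf

/-- The law of the information and the next episode. -/
theorem map_law_info_episode (alg : Algorithm S A H) (M : MDP S A H) (k : ℕ) :
    (alg.law M).map (fun ω => (info k ω, (ω k).2)) =
      (alg.law M).map (info k) ⊗ₘ M.episodeKernel.comap _ (alg.measurable_play k) := by
  refine Measure.ext_of_lintegral _ fun f hf => ?_
  rw [lintegral_map hf (by fun_prop), lintegral_law_info_episode _ _ _ hf,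
    Measure.lintegral_compProd hf, lintegral_map _ (by fun_prop)]
  · rfl
  · exact Measurable.lintegral_kernel_prod_right' hf

variable {M M' : MDP S A H} {c : ℝ≥0∞} {ℓ : Episode S A H → ℝ≥0∞}

/-- The likelihood of a list of rounds. -/
noncomputable def likelihood (ℓ : Episode S A H → ℝ≥0∞) {k : ℕ} (y : Fin k → unitInterval × Episode S A H) :
    ℝ≥0∞ := ∏ i, ℓ (y i).2

theorem measurable_likelihood (hℓ : Measurable ℓ) (k : ℕ) :
    Measurable (likelihood ℓ (k := k)) := by
  unfold likelihood; fun_prop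

theorem likelihood_append {k : ℕ} (y : Fin k → unitInterval × Episode S A H)
    (x : unitInterval × Episode S A H) :
    likelihood ℓ (append y x) = likelihood ℓ y * ℓ x.2 := by
  unfold likelihood
  rw [Fin.prod_univ_castSucc]
  simp [append]

/-- If `ℓ` bounds from below the density of the episodes of `M'` with respect to those of `M`, up
to a constant factor, then so does the product of the `ℓ`s for the interactions of an algorithm
with `M'` and `M`. -/
theorem lintegral_rounds_likelihood_le (alg : Algorithm S A H) (hℓ : Measurable ℓ)
    (h : ∀ π, c • (M.episodeLaw π).withDensity ℓ ≤ M'.episodeLaw π) (k : ℕ) :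
    ∀ f : (Fin k → unitInterval × Episode S A H) → ℝ≥0∞, Measurable f →
    c ^ k * ∫⁻ ω, f (rounds k ω) * likelihood ℓ (rounds k ω) ∂alg.law M ≤
      ∫⁻ ω, f (rounds k ω) ∂alg.law M' := by
  induction k with
  | zero =>
    intro f _
    have : ∀ ω : ℕ → unitInterval × Episode S A H, f (rounds 0 ω) = f Fin.elim0 :=
      fun ω => congrArg f (Subsingleton.elim _ _)
    simp [this, likelihood]
  | succ k ih =>
    intro f hf
    have mℓ := measurable_likelihood hℓ k
    simp_rw [← append_rounds, likelihood_append]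
    rw [lintegral_law_round alg M k (f := fun p => f (append p.1 p.2) *
        (likelihood ℓ p.1 * ℓ p.2.2)) (by fun_prop),
      lintegral_law_round alg M' k (f := fun p => f (append p.1 p.2)) (by fun_prop)]
    -- Integrating out the last round under `M'` gives a new test function of the first `k` rounds;
    -- this is why the induction quantifies over all `f`.
    set F : (Fin k → unitInterval × Episode S A H) → ℝ≥0∞ := fun y =>
      ∫⁻ u, ∫⁻ e, f (append y (u, e)) ∂M'.episodeLaw (alg.play k (y, u))
        ∂(volume : Measure unitInterval) with hF
    have mF0 : Measurable fun x : Info S A H k =>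
        ∫⁻ e, f (append x.1 (x.2, e)) ∂M'.episodeLaw (alg.play k x) :=
      Measurable.lintegral_kernel_prod_right'
        (κ := M'.episodeKernel.comap _ (alg.measurable_play k))
        (f := fun p : Info S A H k × Episode S A H => f (append p.1.1 (p.1.2, p.2))) (by fun_prop)
    have mF : Measurable F := mF0.lintegral_prod_right'
    refine le_trans ?_ (ih F mF)
    rw [pow_succ, mul_assoc]
    refine mul_le_mul_right ?_ _
    have mG : Measurable fun x : Info S A H k =>
        ∫⁻ e, f (append x.1 (x.2, e)) * (likelihood ℓ x.1 * ℓ e) ∂M.episodeLaw (alg.play k x) :=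
      Measurable.lintegral_kernel_prod_right'
        (κ := M.episodeKernel.comap _ (alg.measurable_play k))
        (f := fun p : Info S A H k × Episode S A H =>
          f (append p.1.1 (p.1.2, p.2)) * (likelihood ℓ p.1.1 * ℓ p.2)) (by fun_prop)
    rw [← lintegral_const_mul _ (by exact mG.lintegral_prod_right'.comp (measurable_rounds k))]
    refine lintegral_mono fun ω => ?_
    simp only [hF]
    rw [← lintegral_const_mul _ (by exact mG.comp (by fun_prop)),
      ← lintegral_mul_const _ (by exact mF0.comp (by fun_prop))]
    refine lintegral_mono fun u => ?_
    have h1 : Measurable fun e => f (append (rounds k ω) (u, e)) := by fun_prop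
    calc c * ∫⁻ e, f (append (rounds k ω) (u, e)) * (likelihood ℓ (rounds k ω) * ℓ e)
          ∂M.episodeLaw (alg.play k (rounds k ω, u))
        = (∫⁻ e, f (append (rounds k ω) (u, e)) ∂(c • (M.episodeLaw
          (alg.play k (rounds k ω, u))).withDensity ℓ)) * likelihood ℓ (rounds k ω) := by
          rw [lintegral_smul_measure, smul_eq_mul, lintegral_withDensity_eq_lintegral_mul _ hℓ h1,
            mul_assoc, ← lintegral_mul_const _ (by fun_prop)]
          congr 2
          funext e
          simp only [Pi.mul_apply]
          ring
      _ ≤ _ := mul_le_mul_left (lintegral_mono' (h _) le_rfl) _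

/-- The fresh random number has the same law under both MDPs and does not enter the likelihood, so
it can be integrated out of `f`. -/
theorem lintegral_info_likelihood_le (alg : Algorithm S A H) (hℓ : Measurable ℓ)
    (h : ∀ π, c • (M.episodeLaw π).withDensity ℓ ≤ M'.episodeLaw π) (k : ℕ)
    {f : Info S A H k → ℝ≥0∞} (hf : Measurable f) :
    c ^ k * ∫⁻ ω, f (info k ω) * likelihood ℓ (rounds k ω) ∂alg.law M ≤
      ∫⁻ ω, f (info k ω) ∂alg.law M' := by
  have mℓ := measurable_likelihood hℓ k
  have h1 := lintegral_law_info alg M k (f := fun x => f x * likelihood ℓ x.1) (by fun_prop)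
  rw [lintegral_law_info alg M' k hf]
  refine le_trans (le_of_eq ?_) (lintegral_rounds_likelihood_le alg hℓ h k
    (fun y => ∫⁻ u, f (y, u) ∂(volume : Measure unitInterval)) hf.lintegral_prod_right')
  congr 1
  refine h1.trans (lintegral_congr fun ω => ?_)
  exact lintegral_mul_const (f := fun u => f (rounds k ω, u)) (likelihood ℓ (rounds k ω))
    (by fun_prop)

end Algorithm

/-! ### State occupancies and visitation probabilities -/

namespace MDP

variable {S A H : ℕ}

/-- The state occupancy `wₕ^π(s)`, by the forward recursion. -/
noncomputable def occ (P0 : stdSimplex ℝ (Fin S))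
    (P : Fin H → Fin S → Fin A → stdSimplex ℝ (Fin S)) (π : Policy S A H) : ℕ → Fin S → ℝ
  | 0, s => P0 s
  | n + 1, s' => if hn : n < H then
      ∑ s, ∑ a, occ P0 P π n s * π ⟨n, hn⟩ s a * P ⟨n, hn⟩ s a s' else 0

theorem occ_succ (P0 : stdSimplex ℝ (Fin S))
    (P : Fin H → Fin S → Fin A → stdSimplex ℝ (Fin S)) (π : Policy S A H) (h : Fin H)
    (s' : Fin S) :
    occ P0 P π (h + 1) s' = ∑ s, ∑ a, occ P0 P π h s * π h s a * P h s a s' := by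
  rw [occ, dif_pos h.isLt]

theorem occ_nonneg (P0 : stdSimplex ℝ (Fin S))
    (P : Fin H → Fin S → Fin A → stdSimplex ℝ (Fin S)) (π : Policy S A H) (n : ℕ) (s : Fin S) :
    0 ≤ occ P0 P π n s := by
  induction n generalizing s with
  | zero => exact P0.2.1 s
  | succ n ih =>
    rw [occ]
    split_ifs with hn
    · exact Finset.sum_nonneg fun s' _ => Finset.sum_nonneg fun a _ =>
        mul_nonneg (mul_nonneg (ih s') ((π _ _).2.1 _)) ((P _ _ _).2.1 _)
    · exact le_rfl

theorem sum_policy (π : Policy S A H) (h : Fin H) (s : Fin S) : ∑ a, π h s a = 1 := (π h s).2.2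

theorem sum_occ (P0 : stdSimplex ℝ (Fin S))
    (P : Fin H → Fin S → Fin A → stdSimplex ℝ (Fin S)) (π : Policy S A H) (n : ℕ) (hn : n ≤ H) :
    ∑ s, occ P0 P π n s = 1 := by
  induction n with
  | zero => exact P0.2.2
  | succ n ih =>
    have hP : ∀ h s a, ∑ s', P h s a s' = 1 := fun h s a => (P h s a).2.2
    simp_rw [occ_succ P0 P π ⟨n, hn⟩]
    rw [Finset.sum_comm]
    rw [← ih (by omega)]
    refine Finset.sum_congr rfl fun s _ => ?_
    rw [Finset.sum_comm]
    simp_rw [← Finset.mul_sum, hP, mul_one, ← Finset.mul_sum, sum_policy, mul_one]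

/-- The occupancies at step `n` depend on the policy only through the steps before `n`. -/
theorem occ_congr (P0 : stdSimplex ℝ (Fin S))
    (P : Fin H → Fin S → Fin A → stdSimplex ℝ (Fin S)) {π π' : Policy S A H} {n : ℕ}
    (hπ : ∀ h : Fin H, h.val < n → π h = π' h) (s : Fin S) :
    occ P0 P π n s = occ P0 P π' n s := by
  induction n generalizing s with
  | zero => rfl
  | succ n ih =>
    rw [occ, occ]
    split_ifs with hn
    · simp_rw [ih (fun h hh => hπ h (by omega)), hπ ⟨n, hn⟩ (by simp)]
    · rfl

theorem sum_comm_pairs (f : Fin S → Fin A → Fin S → Fin A → ℝ) :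
    ∑ s, ∑ a, ∑ t, ∑ b, f s a t b = ∑ t, ∑ b, ∑ s, ∑ a, f s a t b := by
  simp_rw [← Fintype.sum_prod_type']
  let e : (Fin S × Fin A × Fin S × Fin A) ≃ (Fin S × Fin A × Fin S × Fin A) :=
    { toFun := fun x => (x.2.2.1, x.2.2.2, x.1, x.2.1)
      invFun := fun x => (x.2.2.1, x.2.2.2, x.1, x.2.1) }
  exact e.sum_comp fun x => f x.2.2.1 x.2.2.2 x.1 x.2.1

/-- `occ` recurses at the last step, `pathProb_cons` peels off the first one. Conditioning on the
first step reconciles the two recursions. -/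
theorem occ_shift (P0 : stdSimplex ℝ (Fin S))
    (P : Fin (H + 1) → Fin S → Fin A → stdSimplex ℝ (Fin S)) (π : Policy S A (H + 1)) (n : ℕ)
    (s' : Fin S) :
    occ P0 P π (n + 1) s' = ∑ s, ∑ a, P0 s * π 0 s a *
      occ (P 0 s a) (fun h => P h.succ) (fun h => π h.succ) n s' := by
  induction n generalizing s' with
  | zero => rw [occ, dif_pos (Nat.succ_pos _)]; rfl
  | succ n ih =>
    rw [occ]
    split_ifs with hn
    · have hn' : n < H := by omega
      simp_rw [ih]
      simp only [occ, dif_pos hn', Finset.mul_sum, Finset.sum_mul]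
      have e : (⟨n + 1, hn⟩ : Fin (H + 1)) = Fin.succ ⟨n, hn'⟩ := rfl
      rw [sum_comm_pairs]
      simp_rw [e]
      refine Finset.sum_congr rfl fun x _ => Finset.sum_congr rfl fun y _ =>
        Finset.sum_congr rfl fun z _ => Finset.sum_congr rfl fun w _ => ?_
      ring
    · have hn' : ¬ n < H := by omega
      simp [occ, hn']

theorem sum_pathProb_mul (P0 : stdSimplex ℝ (Fin S))
    (P : Fin H → Fin S → Fin A → stdSimplex ℝ (Fin S)) (π : Policy S A H) (h : Fin H)
    (f : Fin S × Fin A → ℝ) :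
    ∑ p, pathProb P0 P π p * f (p h) = ∑ s, ∑ a, occ P0 P π h s * π h s a * f (s, a) := by
  induction H generalizing P0 with
  | zero => exact h.elim0
  | succ n ih =>
    rw [← (Fin.consEquiv (fun _ : Fin (n + 1) => Fin S × Fin A)).sum_comp, Fintype.sum_prod_type]
    have key : ∀ (x : Fin S × Fin A) (p : Fin n → Fin S × Fin A),
        pathProb P0 P π (Fin.consEquiv (fun _ : Fin (n + 1) => Fin S × Fin A) (x, p)) =
          P0 x.1 * π 0 x.1 x.2 *
            pathProb (P 0 x.1 x.2) (fun h => P h.succ) (fun h => π h.succ) p :=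
      fun x p => pathProb_cons P0 P π x p
    simp_rw [key]
    refine Fin.cases ?_ (fun h => ?_) h
    · have e : ∀ (x : Fin S × Fin A) (p : Fin n → Fin S × Fin A),
          Fin.consEquiv (fun _ : Fin (n + 1) => Fin S × Fin A) (x, p) 0 = x := fun _ _ => rfl
      simp_rw [e, ← Finset.sum_mul, ← Finset.mul_sum, sum_pathProb, mul_one]
      rw [Fintype.sum_prod_type]
      rfl
    · have e : ∀ (x : Fin S × Fin A) (p : Fin n → Fin S × Fin A),
          Fin.consEquiv (fun _ : Fin (n + 1) => Fin S × Fin A) (x, p) h.succ = p h :=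
        fun _ _ => rfl
      simp_rw [e, mul_assoc, ← Finset.mul_sum, ih]
      rw [Fintype.sum_prod_type]
      simp only [Fin.val_succ, occ_shift, Finset.mul_sum, Finset.sum_mul]
      rw [sum_comm_pairs]
      refine Finset.sum_congr rfl fun x _ => Finset.sum_congr rfl fun y _ =>
        Finset.sum_congr rfl fun z _ => Finset.sum_congr rfl fun w _ => ?_
      ring

theorem lintegral_episodeLaw (M : MDP S A H) (π : Policy S A H) {f : Episode S A H → ℝ≥0∞}
    (hf : Measurable f) :
    ∫⁻ e, f e ∂M.episodeLaw π = ∑ p, ENNReal.ofReal (pathProb M.P0 M.P π p) *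
      ∫⁻ r, f (fun h => ((p h).1, (p h).2, r h))
        ∂Measure.pi fun h => (M.R h (p h).1 (p h).2 : Measure unitInterval) := by
  unfold episodeLaw
  rw [lintegral_finsetSum_measure]
  refine Finset.sum_congr rfl fun p _ => ?_
  rw [lintegral_smul_measure, lintegral_map hf (by fun_prop), smul_eq_mul]

/-- The law of the state, the action and the reward at step `h`. -/
theorem lintegral_episodeLaw_step (M : MDP S A H) (π : Policy S A H) (h : Fin H)
    {f : Fin S × Fin A × unitInterval → ℝ≥0∞} (hf : Measurable f) :
    ∫⁻ e, f (e h) ∂M.episodeLaw π = ∑ s, ∑ a, ENNReal.ofReal (occ M.P0 M.P π h s * π h s a) *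
      ∫⁻ r, f (s, a, r) ∂(M.R h s a : Measure unitInterval) := by
  rw [lintegral_episodeLaw M π (f := fun e => f (e h)) (by fun_prop)]
  set g : Fin S × Fin A → ℝ≥0∞ :=
    fun x => ∫⁻ r, f (x.1, x.2, r) ∂(M.R h x.1 x.2 : Measure unitInterval) with hg
  have h1 : ∀ p : Fin H → Fin S × Fin A, ∫⁻ r : Fin H → unitInterval, f ((p h).1, (p h).2, r h)
      ∂(Measure.pi fun h => (M.R h (p h).1 (p h).2 : Measure unitInterval)) = g (p h) := fun p =>
    (measurePreserving_eval (fun h => (M.R h (p h).1 (p h).2 : Measure unitInterval)) h).lintegral_comp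
      (f := fun r => f ((p h).1, (p h).2, r)) (by fun_prop)
  simp_rw [h1]
  -- `g` may be infinite while `sum_pathProb_mul` is about real functions, so `g (p h)` is expanded
  -- over indicators.
  have h2 : ∀ p : Fin H → Fin S × Fin A, ENNReal.ofReal (pathProb M.P0 M.P π p) * g (p h) =
      ∑ x, ENNReal.ofReal (pathProb M.P0 M.P π p * if p h = x then 1 else 0) * g x := by
    intro p
    rw [Finset.sum_eq_single (p h)]
    · simp
    · intro x _ hx; simp [hx.symm]
    · simp
  simp_rw [h2]
  rw [Finset.sum_comm, Fintype.sum_prod_type]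
  refine Finset.sum_congr rfl fun s _ => Finset.sum_congr rfl fun a _ => ?_
  rw [← Finset.sum_mul, ← ENNReal.ofReal_sum_of_nonneg, sum_pathProb_mul M.P0 M.P π h
    (fun y => if y = (s, a) then 1 else 0), Finset.sum_eq_single s, Finset.sum_eq_single a]
  · simp [hg]
  · intro b _ hb; simp [hb]
  · simp
  · intro b _ hb; simp [hb]
  · simp
  · intro p _
    exact mul_nonneg (pathProb_nonneg _ _ _ _) (by split_ifs <;> simp)

theorem visit_eq (M : MDP S A H) (π : Policy S A H) (h : Fin H) (s : Fin S) (a : Fin A) :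
    M.visit π h s a = ENNReal.ofReal (occ M.P0 M.P π h s * π h s a) := by
  have hm : MeasurableSet {x : Fin S × Fin A × unitInterval | x.1 = s ∧ x.2.1 = a} :=
    (measurableSet_eq_fun measurable_fst measurable_const).inter
      (measurableSet_eq_fun (by fun_prop) measurable_const)
  have h1 := lintegral_episodeLaw_step M π h (f := Set.indicator
    {x : Fin S × Fin A × unitInterval | x.1 = s ∧ x.2.1 = a} 1) (measurable_one.indicator hm)
  have h2 : (fun e : Episode S A H => Set.indicator
      {x : Fin S × Fin A × unitInterval | x.1 = s ∧ x.2.1 = a} (1 : Fin S × Fin A × unitInterval → ℝ≥0∞) (e h)) =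
      Set.indicator {e | (e h).1 = s ∧ (e h).2.1 = a} 1 := rfl
  have hm' : MeasurableSet {e : Episode S A H | (e h).1 = s ∧ (e h).2.1 = a} :=
    measurableSet_preimage (f := fun e : Episode S A H => e h) (by fun_prop) hm
  rw [h2, lintegral_indicator_one hm'] at h1
  unfold visit
  rw [h1, Finset.sum_eq_single s, Finset.sum_eq_single a]
  · simp
  · intro b _ hb; simp [hb]
  · simp
  · intro b _ hb; simp [hb]
  · simp

theorem visitState_eq (M : MDP S A H) (π : Policy S A H) (h : Fin H) (s : Fin S) :
    M.visitState π h s = ENNReal.ofReal (occ M.P0 M.P π h s) := by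
  have hm : MeasurableSet {x : Fin S × Fin A × unitInterval | x.1 = s} :=
    measurableSet_eq_fun measurable_fst measurable_const
  have h1 := lintegral_episodeLaw_step M π h (f := Set.indicator
    {x : Fin S × Fin A × unitInterval | x.1 = s} 1) (measurable_one.indicator hm)
  have h2 : (fun e : Episode S A H => Set.indicator
      {x : Fin S × Fin A × unitInterval | x.1 = s} (1 : Fin S × Fin A × unitInterval → ℝ≥0∞) (e h)) =
      Set.indicator {e | (e h).1 = s} 1 := rfl
  have hm' : MeasurableSet {e : Episode S A H | (e h).1 = s} :=
    measurableSet_preimage (f := fun e : Episode S A H => e h) (by fun_prop) hm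
  rw [h2, lintegral_indicator_one hm'] at h1
  unfold visitState
  rw [h1, Finset.sum_eq_single s]
  · simp only [Set.indicator, Set.mem_ofPred_eq, if_true, Pi.one_apply, lintegral_one,
      measure_univ, mul_one]
    rw [← ENNReal.ofReal_sum_of_nonneg, ← Finset.mul_sum, sum_policy, mul_one]
    exact fun a _ => mul_nonneg (occ_nonneg _ _ _ _ _) ((π h s).2.1 a)
  · intro b _ hb; simp [hb]
  · simp

theorem measurable_visit (M : MDP S A H) (h : Fin H) (s : Fin S) (a : Fin A) :
    Measurable fun π => M.visit π h s a := by
  have hm : MeasurableSet {x : Fin S × Fin A × unitInterval | x.1 = s ∧ x.2.1 = a} :=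
    (measurableSet_eq_fun measurable_fst measurable_const).inter
      (measurableSet_eq_fun (by fun_prop) measurable_const)
  exact M.episodeKernel.measurable_coe
    (measurableSet_preimage (f := fun e : Episode S A H => e h) (by fun_prop) hm)

theorem sum_visit (M : MDP S A H) (π : Policy S A H) (h : Fin H) (s : Fin S) :
    ∑ a, M.visit π h s a = M.visitState π h s := by
  simp_rw [visit_eq]
  rw [visitState_eq, ← ENNReal.ofReal_sum_of_nonneg, ← Finset.mul_sum, sum_policy, mul_one]
  exact fun a _ => mul_nonneg (occ_nonneg _ _ _ _ _) ((π h s).2.1 a)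

theorem visitState_zero (M : MDP S A H) (π : Policy S A H) (h : Fin H) (hh : h.val = 0)
    (s : Fin S) : M.visitState π h s = ENNReal.ofReal (M.P0 s) := by
  rw [visitState_eq, hh]; rfl

theorem visitState_succ (M : MDP S A H) (π : Policy S A H) (h h' : Fin H)
    (hh : h'.val = h.val + 1) (s' : Fin S) :
    M.visitState π h' s' = ∑ s, ∑ a, M.visit π h s a * ENNReal.ofReal (M.P h s a s') := by
  have h0 : ∀ s a, 0 ≤ occ M.P0 M.P π h s * π h s a := fun s a =>
    mul_nonneg (occ_nonneg _ _ _ _ _) ((π h s).2.1 a)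
  have h1 : ∀ s a, 0 ≤ occ M.P0 M.P π h s * π h s a * M.P h s a s' := fun s a =>
    mul_nonneg (h0 s a) ((M.P h s a).2.1 _)
  rw [visitState_eq, hh, occ_succ, ENNReal.ofReal_sum_of_nonneg
    (fun s _ => Finset.sum_nonneg fun a _ => h1 s a)]
  refine Finset.sum_congr rfl fun s _ => ?_
  rw [ENNReal.ofReal_sum_of_nonneg (fun a _ => h1 s a)]
  refine Finset.sum_congr rfl fun a _ => ?_
  rw [ENNReal.ofReal_mul (h0 s a), visit_eq]

end MDP

/-! ### Mixtures of policies and easy exploration -/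

/-- The uniform distribution. -/
noncomputable def uniformDist (n : ℕ) (hn : 0 < n) : stdSimplex ℝ (Fin n) :=
  ⟨fun _ => (n : ℝ)⁻¹, fun _ => by positivity, by
    have : (n : ℝ) ≠ 0 := by positivity
    simp [this]⟩

theorem uniformDist_apply {n : ℕ} (hn : 0 < n) (i : Fin n) : uniformDist n hn i = (n : ℝ)⁻¹ := rfl

namespace MDP

variable {S A H : ℕ}

theorem visit_eq_visitState_mul (M : MDP S A H) (π : Policy S A H) (h : Fin H) (s : Fin S)
    (a : Fin A) : M.visit π h s a = M.visitState π h s * ENNReal.ofReal (π h s a) := by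
  rw [visit_eq, visitState_eq, ENNReal.ofReal_mul (occ_nonneg _ _ _ _ _)]

theorem visitState_le_one (M : MDP S A H) (π : Policy S A H) (h : Fin H) (s : Fin S) :
    M.visitState π h s ≤ 1 := prob_le_one

/-- Mixtures of policies are as good as Markov policies: the average visitation probabilities are
those of a Markov policy. -/
theorem exists_policy_visit_eq_lintegral (hA : 0 < A) (M : MDP S A H)
    (ν : Measure (Policy S A H)) [IsProbabilityMeasure ν] :
    ∃ π' : Policy S A H, ∀ h s a, M.visit π' h s a = ∫⁻ π, M.visit π h s a ∂ν := by
  have hsum : ∀ h s, ∑ a, ∫⁻ π, M.visit π h s a ∂ν = ∫⁻ π, M.visitState π h s ∂ν := by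
    intro h s
    rw [← lintegral_finsetSum _ fun a _ => M.measurable_visit h s a]
    simp_rw [sum_visit]
  have hle : ∀ h s, ∫⁻ π, M.visitState π h s ∂ν ≤ 1 := fun h s =>
    (lintegral_mono fun π => M.visitState_le_one π h s).trans (by simp)
  -- The required policy is the conditional law of the action given the state under the mixture;
  -- where the mixture never visits the state, any distribution serves.
  have hex : ∀ h s, ∃ q : stdSimplex ℝ (Fin A), ∀ a,
      (∫⁻ π, M.visitState π h s ∂ν) * ENNReal.ofReal (q a) = ∫⁻ π, M.visit π h s a ∂ν := by
    intro h s
    have htop : (∫⁻ π, M.visitState π h s ∂ν) ≠ ∞ := ne_top_of_le_ne_top ENNReal.one_ne_top (hle h s)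
    by_cases h0 : ∫⁻ π, M.visitState π h s ∂ν = 0
    · refine ⟨uniformDist A hA, fun a => ?_⟩
      rw [h0, zero_mul]
      have := hsum h s
      rw [h0, Finset.sum_eq_zero_iff] at this
      exact (this a (Finset.mem_univ _)).symm
    · have hxt : ∀ a, (∫⁻ π, M.visit π h s a ∂ν) / ∫⁻ π, M.visitState π h s ∂ν ≠ ∞ := by
        intro a
        refine ENNReal.div_ne_top (ne_top_of_le_ne_top htop ?_) h0
        rw [← hsum]
        exact Finset.single_le_sum (f := fun a => ∫⁻ π, M.visit π h s a ∂ν)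
          (fun _ _ => zero_le) (Finset.mem_univ a)
      refine ⟨⟨fun a => ((∫⁻ π, M.visit π h s a ∂ν) / ∫⁻ π, M.visitState π h s ∂ν).toReal,
        fun a => ENNReal.toReal_nonneg, ?_⟩, fun a => ?_⟩
      · rw [← ENNReal.toReal_sum fun a _ => hxt a]
        simp_rw [div_eq_mul_inv]
        rw [← Finset.sum_mul, hsum, ENNReal.mul_inv_cancel h0 htop, ENNReal.toReal_one]
      · change _ * ENNReal.ofReal (ENNReal.toReal _) = _
        rw [ENNReal.ofReal_toReal (hxt a), ENNReal.mul_div_cancel h0 htop]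
  choose π' hπ' using hex
  -- The forward recursion for the state occupancies is linear in the pair occupancies, so agreement
  -- propagates from one step to the next.
  have key : ∀ n (hn : n < H) s,
      M.visitState π' ⟨n, hn⟩ s = ∫⁻ π, M.visitState π ⟨n, hn⟩ s ∂ν := by
    intro n
    induction n with
    | zero =>
      intro hn s
      simp_rw [M.visitState_zero _ ⟨0, hn⟩ rfl]
      simp
    | succ n ih =>
      intro hn s
      simp_rw [M.visitState_succ _ ⟨n, by omega⟩ ⟨n + 1, hn⟩ rfl]
      rw [lintegral_finsetSum _ fun s' _ => Finset.measurable_sum _ fun a _ =>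
        (M.measurable_visit _ s' a).mul_const _]
      refine Finset.sum_congr rfl fun s' _ => ?_
      rw [lintegral_finsetSum _ fun a _ => (M.measurable_visit _ s' a).mul_const _]
      refine Finset.sum_congr rfl fun a _ => ?_
      rw [lintegral_mul_const _ (M.measurable_visit _ s' a), visit_eq_visitState_mul, ih (by omega),
        hπ']
  refine ⟨π', fun h s a => ?_⟩
  rw [visit_eq_visitState_mul, key h.val h.isLt, hπ']

theorem levelComplexity_le_of_inv_le_visit {M : MDP S A H} {π : Policy S A H} {h : Fin H}
    {C : ℝ≥0∞} (hv : ∀ s a, C⁻¹ ≤ M.visit π h s a)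
    (hgap : ∀ s a, 0 < M.gap h s a → 1 ≤ M.gap h s a) : M.levelComplexity h ≤ C := by
  unfold levelComplexity
  refine (iInf_le _ π).trans (iSup_le fun s => iSup_le fun a => iSup_le fun hg => ?_)
  rw [ENNReal.inv_le_iff_inv_le]
  refine (hv s a).trans ?_
  have : (1 : ℝ≥0∞) ≤ ENNReal.ofReal (M.gap h s a ^ 2) := by
    rw [ENNReal.one_le_ofReal]
    have := hgap s a hg
    nlinarith
  calc M.visit π h s a = M.visit π h s a * 1 := (mul_one _).symm
    _ ≤ _ := mul_le_mul_right this _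

/-- For each state take a policy that nearly attains its reachability, play uniformly at step `h`,
and mix these policies uniformly over the states: each pair keeps a share 1/(SA) of the
reachability, and gaps of at least 1 do no harm. -/
theorem levelComplexity_le_iSup_reach (hS : 0 < S) (hA : 0 < A) (M : MDP S A H) (h : Fin H)
    (hgap : ∀ s a, 0 < M.gap h s a → 1 ≤ M.gap h s a) :
    M.levelComplexity h ≤ S * A * ⨆ s, (M.reach h s)⁻¹ := by
  have hS' : (S : ℝ≥0∞) ≠ 0 := by exact_mod_cast hS.ne'
  have hA' : (A : ℝ≥0∞) ≠ 0 := by exact_mod_cast hA.ne'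
  have hSA : (S * A : ℝ≥0∞) ≠ 0 := mul_ne_zero hS' hA'
  have hSt : (S : ℝ≥0∞) ≠ ∞ := ENNReal.natCast_ne_top S
  have hAt : (A : ℝ≥0∞) ≠ ∞ := ENNReal.natCast_ne_top A
  have hSAt : (S * A : ℝ≥0∞) ≠ ∞ := ENNReal.mul_ne_top hSt hAt
  rw [← ENNReal.div_le_iff' hSA hSAt]
  -- Enlarging the bound to any `c` above the supremum avoids showing that the reachabilities are
  -- attained.
  refine le_of_forall_gt_imp_ge_of_dense fun c hc => ?_
  rw [ENNReal.div_le_iff' hSA hSAt]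
  have hex : ∀ s, ∃ π : Policy S A H, c⁻¹ < M.visitState π h s := by
    intro s
    have h1 : c⁻¹ < M.reach h s := by
      rw [← inv_inv (M.reach h s), ENNReal.inv_lt_inv]
      exact (le_iSup (fun s => (M.reach h s)⁻¹) s).trans_lt hc
    exact lt_iSup_iff.1 h1
  choose π hπ using hex
  set π₁ : Fin S → Policy S A H := fun s => Function.update (π s) h fun _ => uniformDist A hA
  have hπ₁ : ∀ s a, (A : ℝ≥0∞)⁻¹ * c⁻¹ ≤ M.visit (π₁ s) h s a := by
    intro s a
    have h1 : M.visitState (π₁ s) h s = M.visitState (π s) h s := by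
      rw [visitState_eq, visitState_eq]
      congr 1
      -- Changing the policy at step `h` leaves the state occupancy at step `h` unchanged.
      refine occ_congr _ _ (fun g hg => ?_) s
      exact Function.update_of_ne (by rintro rfl; omega) _ _
    have h2 : ENNReal.ofReal (π₁ s h s a) = (A : ℝ≥0∞)⁻¹ := by
      simp only [π₁, Function.update_self, uniformDist_apply]
      rw [ENNReal.ofReal_inv_of_pos (by exact_mod_cast hA), ENNReal.ofReal_natCast]
    rw [visit_eq_visitState_mul, h1, h2, mul_comm]
    exact mul_le_mul_left (hπ s).le _
  set ν : Measure (Policy S A H) := ∑ s, (S : ℝ≥0∞)⁻¹ • Measure.dirac (π₁ s)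
  have : IsProbabilityMeasure ν := by
    constructor
    simp [ν, ENNReal.mul_inv_cancel hS' hSt]
  obtain ⟨π', hπ'⟩ := exists_policy_visit_eq_lintegral hA M ν
  refine levelComplexity_le_of_inv_le_visit (π := π') (fun s a => ?_) hgap
  rw [hπ', lintegral_finsetSum_measure]
  refine le_trans ?_ (Finset.single_le_sum (fun _ _ => zero_le) (Finset.mem_univ s))
  rw [lintegral_smul_measure, lintegral_dirac' _ (M.measurable_visit h s a), smul_eq_mul,
    ENNReal.mul_inv (Or.inl hSA) (Or.inl hSAt), ENNReal.mul_inv (Or.inl hS') (Or.inl hSt), mul_assoc]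
  exact mul_le_mul_right (hπ₁ s a) _

end MDP

/-! ### Greedy policies, gaps and the performance difference -/

/-- The deterministic policy that plays `d h s`. -/
noncomputable def detPolicy {S A H : ℕ} (d : Fin H → Fin S → Fin A) : Policy S A H :=
  fun h s => ⟨Pi.single (d h s) 1, single_mem_stdSimplex ℝ (d h s)⟩

namespace MDP

variable {S A H : ℕ}

theorem kernel_nonneg (M : MDP S A H) (h : Fin H) (s : Fin S) (a : Fin A) (s' : Fin S) :
    0 ≤ M.P h s a s' := (M.P h s a).2.1 s'

theorem policy_nonneg (π : Policy S A H) (h : Fin H) (s : Fin S) (a : Fin A) : 0 ≤ π h s a :=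
  (π h s).2.1 a

theorem V_eq_sum_Q (M : MDP S A H) (π : Policy S A H) (h : Fin H) (s : Fin S) :
    M.V π h s = ∑ a, π h s a * M.Q π h s a := by
  rw [V, dif_pos h.isLt]; rfl

theorem V_of_le (M : MDP S A H) (π : Policy S A H) {n : ℕ} (hn : H ≤ n) (s : Fin S) :
    M.V π n s = 0 := by
  rw [V, dif_neg (by omega)]

theorem V_detPolicy (M : MDP S A H) (d : Fin H → Fin S → Fin A) (h : Fin H) (s : Fin S) :
    M.V (detPolicy d) h s = M.Q (detPolicy d) h s (d h s) := by
  rw [V_eq_sum_Q, Finset.sum_eq_single (d h s)]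
  · have : detPolicy d h s (d h s) = 1 := Pi.single_eq_same (M := fun _ => ℝ) _ _
    rw [this, one_mul]
  · intro b _ hb
    have : detPolicy d h s b = 0 := Pi.single_eq_of_ne (M := fun _ => ℝ) hb _
    rw [this, zero_mul]
  · simp

/-- A deterministic policy is greedy if it is optimal with respect to its own `Q`-function. -/
def IsGreedy (M : MDP S A H) (d : Fin H → Fin S → Fin A) : Prop :=
  ∀ h s a, M.Q (detPolicy d) h s a ≤ M.Q (detPolicy d) h s (d h s)

variable {M : MDP S A H} {d : Fin H → Fin S → Fin A}

theorem Q_le_of_V_le {π π' : Policy S A H} {h : Fin H}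
    (hV : ∀ s, M.V π (h + 1) s ≤ M.V π' (h + 1) s) (s : Fin S) (a : Fin A) :
    M.Q π h s a ≤ M.Q π' h s a := by
  unfold Q
  gcongr with s'
  · exact M.kernel_nonneg h s a s'
  · exact hV s'

/-- Backward induction on the remaining steps: a larger continuation value gives a larger `Q`, and
greediness beats any average over actions. -/
theorem IsGreedy.V_le (hd : M.IsGreedy d) (π : Policy S A H) (n : ℕ) (s : Fin S) :
    M.V π n s ≤ M.V (detPolicy d) n s := by
  suffices ∀ m n : ℕ, H ≤ n + m → ∀ s, M.V π n s ≤ M.V (detPolicy d) n s from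
    this H n (by omega) s
  intro m
  induction m with
  | zero => intro n hn s; rw [V_of_le M _ (by omega), V_of_le M _ (by omega)]
  | succ m ih =>
    intro n hn s
    by_cases h : n < H
    · have e1 := M.V_eq_sum_Q π ⟨n, h⟩ s
      have e2 := M.V_detPolicy d ⟨n, h⟩ s
      simp only at e1 e2
      rw [e1, e2, ← one_mul (M.Q (detPolicy d) _ s _), ← sum_policy π ⟨n, h⟩ s, Finset.sum_mul]
      refine Finset.sum_le_sum fun a _ => mul_le_mul_of_nonneg_left ?_ (policy_nonneg π _ s a)
      exact (Q_le_of_V_le (h := ⟨n, h⟩) (ih (n + 1) (by omega)) s a).trans (hd _ s a)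
    · rw [V_of_le M _ (by omega), V_of_le M _ (by omega)]

theorem IsGreedy.Q_le (hd : M.IsGreedy d) (π : Policy S A H) (h : Fin H) (s : Fin S) (a : Fin A) :
    M.Q π h s a ≤ M.Q (detPolicy d) h s a :=
  Q_le_of_V_le (fun s => hd.V_le π _ s) s a

theorem ciSup_eq_of_forall_le {ι : Type*} {f : ι → ℝ} {i : ι} (h : ∀ j, f j ≤ f i) :
    ⨆ j, f j = f i :=
  have : Nonempty ι := ⟨i⟩
  le_antisymm (ciSup_le h) (le_ciSup (f := f) ⟨f i, by rintro _ ⟨j, rfl⟩; exact h j⟩ i)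

theorem IsGreedy.gap_eq (hd : M.IsGreedy d) (h : Fin H) (s : Fin S) (a : Fin A) :
    M.gap h s a = M.Q (detPolicy d) h s (d h s) - M.Q (detPolicy d) h s a := by
  unfold gap Vstar Qstar
  rw [ciSup_eq_of_forall_le (fun π => hd.V_le π _ s), ciSup_eq_of_forall_le
    (fun π => hd.Q_le π h s a), V_detPolicy]

theorem IsGreedy.gap_nonneg (hd : M.IsGreedy d) (h : Fin H) (s : Fin S) (a : Fin A) :
    0 ≤ M.gap h s a := by
  rw [hd.gap_eq]; exact sub_nonneg.2 (hd h s a)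

theorem IsGreedy.optValue_eq (hd : M.IsGreedy d) : M.optValue = M.value (detPolicy d) := by
  unfold optValue
  refine ciSup_eq_of_forall_le fun π => ?_
  unfold value
  exact Finset.sum_le_sum fun s _ => mul_le_mul_of_nonneg_left (hd.V_le π 0 s) (M.P0.2.1 s)

/-- The performance difference lemma. -/
theorem IsGreedy.sum_occ_mul_V_sub (hd : M.IsGreedy d) (π : Policy S A H) (h : Fin H) :
    ∑ s, occ M.P0 M.P π h s * (M.V (detPolicy d) h s - M.V π h s) =
      ∑ s, ∑ a, occ M.P0 M.P π h s * π h s a * M.gap h s a +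
      ∑ s, occ M.P0 M.P π (h + 1) s * (M.V (detPolicy d) (h + 1) s - M.V π (h + 1) s) := by
  simp_rw [occ_succ, Finset.sum_mul]
  have hcomm : ∀ f : Fin S → Fin S → Fin A → ℝ,
      ∑ s', ∑ s, ∑ a, f s' s a = ∑ s, ∑ a, ∑ s', f s' s a := fun f => by
    rw [Finset.sum_comm]
    exact Finset.sum_congr rfl fun s _ => Finset.sum_comm
  rw [hcomm, ← Finset.sum_add_distrib]
  refine Finset.sum_congr rfl fun s _ => ?_
  rw [← Finset.sum_add_distrib, V_detPolicy, V_eq_sum_Q,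
    ← one_mul (M.Q (detPolicy d) _ s _), ← sum_policy π h s, Finset.sum_mul,
    ← Finset.sum_sub_distrib, Finset.mul_sum]
  refine Finset.sum_congr rfl fun a _ => ?_
  have h1 : M.Q (detPolicy d) h s a - M.Q π h s a =
      ∑ s', M.P h s a s' * (M.V (detPolicy d) (h + 1) s' - M.V π (h + 1) s') := by
    unfold Q
    simp_rw [mul_sub, Finset.sum_sub_distrib]
    ring
  simp_rw [mul_assoc, ← Finset.mul_sum, ← h1, hd.gap_eq]
  ring

/-- Playing a suboptimal action at a reachable state costs. -/
theorem IsGreedy.occ_mul_gap_le (hd : M.IsGreedy d) (π : Policy S A H) (h : Fin H) (s : Fin S)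
    (a : Fin A) :
    occ M.P0 M.P π h s * π h s a * M.gap h s a ≤ M.optValue - M.value π := by
  -- `L n` is the regret incurred from step `n` on. It decreases by the expected gap at each step,
  -- so the total regret `L 0` dominates every single gap term.
  set L : ℕ → ℝ := fun n => ∑ s, occ M.P0 M.P π n s * (M.V (detPolicy d) n s - M.V π n s) with hL
  have hL0 : ∀ n, 0 ≤ L n := fun n => Finset.sum_nonneg fun s _ =>
    mul_nonneg (occ_nonneg _ _ _ _ _) (sub_nonneg.2 (hd.V_le π n s))
  have hpos : ∀ (h : Fin H) s a, 0 ≤ occ M.P0 M.P π h s * π h s a * M.gap h s a := fun h s a =>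
    mul_nonneg (mul_nonneg (occ_nonneg _ _ _ _ _) (policy_nonneg π h s a)) (hd.gap_nonneg h s a)
  have hstep : ∀ h : Fin H, L h = ∑ s, ∑ a, occ M.P0 M.P π h s * π h s a * M.gap h s a +
      L (h + 1) := fun h => hd.sum_occ_mul_V_sub π h
  have hmono : ∀ n, n < H → L (n + 1) ≤ L n := by
    intro n hn
    have := hstep ⟨n, hn⟩
    simp only at this
    rw [this]
    exact le_add_of_nonneg_left (Finset.sum_nonneg fun s _ => Finset.sum_nonneg fun a _ =>
      hpos ⟨n, hn⟩ s a)
  have hle0 : ∀ n, n ≤ H → L n ≤ L 0 := by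
    intro n
    induction n with
    | zero => intro _; exact le_rfl
    | succ n ih => intro hn; exact (hmono n hn).trans (ih (by omega))
  have h0 : L 0 = M.optValue - M.value π := by
    rw [hd.optValue_eq]
    simp only [hL, value, ← Finset.sum_sub_distrib, mul_sub]
    rfl
  rw [← h0]
  refine le_trans ?_ (hle0 h h.isLt.le)
  rw [hstep]
  have h1 : occ M.P0 M.P π h s * π h s a * M.gap h s a ≤
      ∑ a, occ M.P0 M.P π h s * π h s a * M.gap h s a :=
    Finset.single_le_sum (f := fun a => occ M.P0 M.P π h s * π h s a * M.gap h s a)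
      (fun a _ => hpos h s a) (Finset.mem_univ a)
  have h2 : ∑ a, occ M.P0 M.P π h s * π h s a * M.gap h s a ≤
      ∑ s, ∑ a, occ M.P0 M.P π h s * π h s a * M.gap h s a :=
    Finset.single_le_sum (f := fun s => ∑ a, occ M.P0 M.P π h s * π h s a * M.gap h s a)
      (fun s _ => Finset.sum_nonneg fun a _ => hpos h s a) (Finset.mem_univ s)
  linarith [hL0 (h + 1)]

/-- An optimal policy plays the optimal action at every state that it visits. -/
theorem IsGreedy.policy_eq_one (hd : M.IsGreedy d) {π : Policy S A H}
    (hπ : M.optValue - M.value π ≤ 0) {h : Fin H} {s : Fin S} (hs : 0 < occ M.P0 M.P π h s)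
    (hg : ∀ a, a ≠ d h s → 0 < M.gap h s a) : π h s (d h s) = 1 := by
  have h0 : ∀ a, a ≠ d h s → π h s a = 0 := by
    intro a ha
    have h1 := (hd.occ_mul_gap_le π h s a).trans hπ
    by_contra hne
    have h2 : 0 < π h s a := lt_of_le_of_ne (policy_nonneg π h s a) (Ne.symm hne)
    have := mul_pos (mul_pos hs h2) (hg a ha)
    linarith
  rw [← sum_policy π h s, Finset.sum_eq_single (d h s) (fun a _ ha => h0 a ha) (by simp)]

end MDP

/-! ### Bernoulli rewards and the gaps they produce -/

/-- The Bernoulli distribution on `{0, 1}` with mean `m`. -/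
noncomputable def bernoulliReward (m : unitInterval) : ProbabilityMeasure unitInterval :=
  ⟨ENNReal.ofReal m • Measure.dirac 1 + ENNReal.ofReal (1 - m) • Measure.dirac 0, ⟨by
    have h1 : (m : ℝ) ≤ 1 := m.2.2
    have h0 : (0 : ℝ) ≤ m := m.2.1
    simp [← ENNReal.ofReal_add h0 (sub_nonneg.2 h1)]⟩⟩

theorem lintegral_bernoulliReward (m : unitInterval) (f : unitInterval → ℝ≥0∞) :
    ∫⁻ r, f r ∂(bernoulliReward m : Measure unitInterval) =
      ENNReal.ofReal m * f 1 + ENNReal.ofReal (1 - m) * f 0 := by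
  simp [bernoulliReward]

theorem integral_bernoulliReward (m : unitInterval) (f : unitInterval → ℝ) :
    ∫ r, f r ∂(bernoulliReward m : Measure unitInterval) = m * f 1 + (1 - m) * f 0 := by
  have h1 : (m : ℝ) ≤ 1 := m.2.2
  have h0 : (0 : ℝ) ≤ m := m.2.1
  have hi : ∀ (c : ℝ) x, Integrable f (ENNReal.ofReal c • Measure.dirac (x : unitInterval)) :=
    fun c x => (integrable_dirac (by simp)).smul_measure ENNReal.ofReal_ne_top
  simp only [bernoulliReward, ProbabilityMeasure.coe_mk]
  rw [integral_add_measure (hi _ _) (hi _ _), integral_smul_measure, integral_smul_measure,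
    integral_dirac, integral_dirac, ENNReal.toReal_ofReal h0, ENNReal.toReal_ofReal (by linarith)]
  rfl

/-- The MDP with Bernoulli rewards of means `μ`. -/
noncomputable def bernoulliMDP {S A H : ℕ} (P0 : stdSimplex ℝ (Fin S))
    (P : Fin H → Fin S → Fin A → stdSimplex ℝ (Fin S))
    (μ : Fin H → Fin S → Fin A → unitInterval) : MDP S A H where
  P0 := P0
  P := P
  R := fun h s a => bernoulliReward (μ h s a)

section Structure

variable {S A H : ℕ} {P0 : stdSimplex ℝ (Fin S)}
  {P : Fin H → Fin S → Fin A → stdSimplex ℝ (Fin S)} {μ : Fin H → Fin S → Fin A → unitInterval}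
  {hbar : Fin H} {d : Fin H → Fin S → Fin A} {θ : ℝ}

theorem meanReward_bernoulliMDP (h : Fin H) (s : Fin S) (a : Fin A) :
    (bernoulliMDP P0 P μ).meanReward h s a = μ h s a := by
  unfold MDP.meanReward bernoulliMDP
  rw [integral_bernoulliReward]
  simp

/-- Mean rewards that are `0` or `1` except at step `hbar`, where the best ones (those of `d`)
differ by at most `θ`. -/
structure IsLeveled (μ : Fin H → Fin S → Fin A → unitInterval) (hbar : Fin H)
    (d : Fin H → Fin S → Fin A) (θ : ℝ) : Prop where
  best : ∀ h s, h ≠ hbar → (μ h s (d h s) : ℝ) = 1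
  other : ∀ h s a, h ≠ hbar → a ≠ d h s → (μ h s a : ℝ) = 0
  le_best : ∀ s, (1 / 2 : ℝ) ≤ μ hbar s (d hbar s)
  best_le : ∀ s, (μ hbar s (d hbar s) : ℝ) ≤ 1 / 2 + θ
  lt_best : ∀ s a, a ≠ d hbar s → (μ hbar s a : ℝ) < μ hbar s (d hbar s)

theorem sum_kernel_mul_mem (p : stdSimplex ℝ (Fin S)) {f : Fin S → ℝ} {c e : ℝ}
    (hf : ∀ s, c ≤ f s ∧ f s ≤ e) : c ≤ ∑ s, p s * f s ∧ ∑ s, p s * f s ≤ e := by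
  have h1 : ∑ s, p s = 1 := p.2.2
  have h0 : ∀ s, 0 ≤ p s := p.2.1
  constructor
  · calc c = ∑ s, p s * c := by rw [← Finset.sum_mul, h1, one_mul]
      _ ≤ _ := Finset.sum_le_sum fun s _ => mul_le_mul_of_nonneg_left (hf s).1 (h0 s)
  · calc _ ≤ ∑ s, p s * e := Finset.sum_le_sum fun s _ => mul_le_mul_of_nonneg_left (hf s).2 (h0 s)
      _ = e := by rw [← Finset.sum_mul, h1, one_mul]

/-- Best rewards equal 1 off `hbar`, so such a step merely shifts values that are averages of the
next ones. Only step `hbar` can create a spread, of size at most `θ`. The transitions are arbitrary,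
which allows both the instance and its smoothed versions. -/
theorem IsLeveled.exists_V_mem (hμ : IsLeveled μ hbar d θ) (hθ : 0 ≤ θ) (n : ℕ) :
    ∃ c : ℝ, ∀ s, c ≤ (bernoulliMDP P0 P μ).V (detPolicy d) n s ∧
      (bernoulliMDP P0 P μ).V (detPolicy d) n s ≤ c + if n ≤ hbar then θ else 0 := by
  suffices ∀ m n : ℕ, H ≤ n + m → ∃ c : ℝ, ∀ s, c ≤ (bernoulliMDP P0 P μ).V (detPolicy d) n s ∧
      (bernoulliMDP P0 P μ).V (detPolicy d) n s ≤ c + if n ≤ hbar then θ else 0 from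
    this H n (by omega)
  have hz : ∀ n : ℕ, H ≤ n → ∃ c : ℝ, ∀ s, c ≤ (bernoulliMDP P0 P μ).V (detPolicy d) n s ∧
      (bernoulliMDP P0 P μ).V (detPolicy d) n s ≤ c + if n ≤ hbar then θ else 0 := by
    intro n hn
    refine ⟨0, fun s => ?_⟩
    rw [MDP.V_of_le _ _ hn]
    exact ⟨le_rfl, by split_ifs <;> simp [hθ]⟩
  intro m
  induction m with
  | zero => intro n hn; exact hz n hn
  | succ m ih =>
    intro n hn
    by_cases h : n < H
    · obtain ⟨c, hc⟩ := ih (n + 1) (by omega)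
      have hV : ∀ s, (bernoulliMDP P0 P μ).V (detPolicy d) n s = μ ⟨n, h⟩ s (d ⟨n, h⟩ s) +
          ∑ s', P ⟨n, h⟩ s (d ⟨n, h⟩ s) s' * (bernoulliMDP P0 P μ).V (detPolicy d) (n + 1) s' := by
        intro s
        have := (bernoulliMDP P0 P μ).V_detPolicy d ⟨n, h⟩ s
        simp only at this
        rw [this, MDP.Q, meanReward_bernoulliMDP]
        rfl
      have hb := fun s => sum_kernel_mul_mem (P ⟨n, h⟩ s (d ⟨n, h⟩ s)) hc
      by_cases hn : (⟨n, h⟩ : Fin H) = hbar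
      · have hn' : n = hbar.val := congrArg Fin.val hn
        refine ⟨c + 1 / 2, fun s => ?_⟩
        have h1 := hμ.le_best s
        have h2 := hμ.best_le s
        have h3 := hb s
        rw [hV, if_pos hn'.le]
        rw [if_neg (by omega)] at h3
        rw [hn] at h3 ⊢
        exact ⟨by linarith, by linarith⟩
      · have hn' : n ≠ hbar.val := fun e => hn (Fin.ext e)
        have e : (if n + 1 ≤ hbar.val then θ else 0) = if n ≤ hbar.val then θ else 0 := by
          congr 1
          simp only [eq_iff_iff]
          omega
        refine ⟨c + 1, fun s => ?_⟩
        have h3 := hb s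
        rw [e] at h3
        rw [hV, hμ.best _ s hn]
        exact ⟨by linarith, by linarith⟩
    · exact hz n (by omega)

/-- After `hbar` the continuation value is exactly constant, so the transitions cancel. -/
theorem IsLeveled.Q_sub (hμ : IsLeveled μ hbar d θ) (hθ : 0 ≤ θ) (s : Fin S) (a : Fin A) :
    (bernoulliMDP P0 P μ).Q (detPolicy d) hbar s (d hbar s) -
      (bernoulliMDP P0 P μ).Q (detPolicy d) hbar s a = μ hbar s (d hbar s) - μ hbar s a := by
  obtain ⟨c, hc⟩ := hμ.exists_V_mem (P0 := P0) (P := P) hθ (hbar + 1)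
  rw [if_neg (by omega)] at hc
  have hb := fun a => sum_kernel_mul_mem (P hbar s a) hc
  have h1 := hb a
  have h2 := hb (d hbar s)
  unfold MDP.Q
  rw [meanReward_bernoulliMDP, meanReward_bernoulliMDP]
  change _ + ∑ s', P hbar s (d hbar s) s' * _ - (_ + ∑ s', P hbar s a s' * _) = _
  linarith

/-- The immediate rewards differ by 1, and the spread of the continuation value recovers at most `θ`
of it. -/
theorem IsLeveled.le_Q_sub (hμ : IsLeveled μ hbar d θ) (hθ : 0 ≤ θ) {h : Fin H} (hh : h ≠ hbar)
    (s : Fin S) {a : Fin A} (ha : a ≠ d h s) :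
    1 - θ ≤ (bernoulliMDP P0 P μ).Q (detPolicy d) h s (d h s) -
      (bernoulliMDP P0 P μ).Q (detPolicy d) h s a := by
  obtain ⟨c, hc⟩ := hμ.exists_V_mem (P0 := P0) (P := P) hθ (h + 1)
  have hb := fun a => sum_kernel_mul_mem (P h s a) hc
  have h1 := hb a
  have h2 := hb (d h s)
  unfold MDP.Q
  rw [meanReward_bernoulliMDP, meanReward_bernoulliMDP, hμ.best h s hh, hμ.other h s a hh ha]
  change _ ≤ _ + ∑ s', P h s (d h s) s' * _ - (_ + ∑ s', P h s a s' * _)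
  have : (if h.val + 1 ≤ hbar.val then θ else 0) ≤ θ := by split_ifs <;> simp [hθ]
  linarith

theorem IsLeveled.isGreedy (hμ : IsLeveled μ hbar d θ) (hθ : 0 ≤ θ) (hθ1 : θ < 1) :
    (bernoulliMDP P0 P μ).IsGreedy d := by
  intro h s a
  by_cases ha : a = d h s
  · rw [ha]
  by_cases hh : h = hbar
  · subst hh
    have h1 := hμ.Q_sub (P0 := P0) (P := P) hθ s a
    have h2 := hμ.lt_best s a ha
    linarith
  · have h1 := hμ.le_Q_sub (P0 := P0) (P := P) hθ hh s ha
    linarith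

theorem IsLeveled.gap_self (hμ : IsLeveled μ hbar d θ) (hθ : 0 ≤ θ) (hθ1 : θ < 1) (h : Fin H)
    (s : Fin S) : (bernoulliMDP P0 P μ).gap h s (d h s) = 0 := by
  rw [(hμ.isGreedy hθ hθ1).gap_eq, sub_self]

theorem IsLeveled.gap_hbar (hμ : IsLeveled μ hbar d θ) (hθ : 0 ≤ θ) (hθ1 : θ < 1) (s : Fin S)
    (a : Fin A) : (bernoulliMDP P0 P μ).gap hbar s a = μ hbar s (d hbar s) - μ hbar s a := by
  rw [(hμ.isGreedy hθ hθ1).gap_eq, hμ.Q_sub hθ]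

theorem IsLeveled.le_gap (hμ : IsLeveled μ hbar d θ) (hθ : 0 ≤ θ) (hθ1 : θ < 1) {h : Fin H}
    (hh : h ≠ hbar) (s : Fin S) {a : Fin A} (ha : a ≠ d h s) :
    1 - θ ≤ (bernoulliMDP P0 P μ).gap h s a := by
  rw [(hμ.isGreedy hθ hθ1).gap_eq]
  exact hμ.le_Q_sub hθ hh s ha

theorem IsLeveled.gap_pos (hμ : IsLeveled μ hbar d θ) (hθ : 0 ≤ θ) (hθ1 : θ < 1) (h : Fin H)
    (s : Fin S) {a : Fin A} (ha : a ≠ d h s) : 0 < (bernoulliMDP P0 P μ).gap h s a := by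
  by_cases hh : h = hbar
  · subst hh
    rw [hμ.gap_hbar hθ hθ1]
    exact sub_pos.2 (hμ.lt_best s a ha)
  · linarith [hμ.le_gap (P0 := P0) (P := P) hθ hθ1 hh s ha]

theorem IsLeveled.hasUniqueOptimalActions (hμ : IsLeveled μ hbar d θ) (hθ : 0 ≤ θ) (hθ1 : θ < 1) :
    (bernoulliMDP P0 P μ).HasUniqueOptimalActions := fun h s =>
  ⟨d h s, hμ.gap_self hθ hθ1 h s, fun a ha => by
    by_contra hne
    exact (hμ.gap_pos hθ hθ1 h s hne).ne' ha⟩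

end Structure

/-! ### Likelihood ratios of rewards and of episodes -/

/-- Changing one factor of a product measure by a density. -/
theorem pi_eq_withDensity {ι X : Type*} [Fintype ι] [DecidableEq ι] [MeasurableSpace X]
    {ν ν' : ι → Measure X} [∀ i, IsFiniteMeasure (ν i)] [∀ i, IsFiniteMeasure (ν' i)] {i : ι}
    {g : X → ℝ≥0∞} (hg : Measurable g) (hne : ∀ j, j ≠ i → ν' j = ν j)
    (hi : ν' i = (ν i).withDensity g) :
    Measure.pi ν' = (Measure.pi ν).withDensity fun r => g (r i) := by
  refine Measure.pi_eq fun s hs => ?_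
  have h1 : ∫⁻ r, g (r i) ∂(Measure.pi fun j => (ν j).restrict (s j)) =
      ∫⁻ x, g x ∂(Measure.pi fun j => (ν j).restrict (s j)).map (Function.eval i) :=
    (lintegral_map hg (measurable_pi_apply i)).symm
  rw [withDensity_apply _ (MeasurableSet.univ_pi hs), Measure.restrict_pi_pi, h1,
    Measure.pi_map_eval, lintegral_smul_measure, ← withDensity_apply _ (hs i), ← hi,
    ← Finset.prod_erase_mul _ _ (Finset.mem_univ i), smul_eq_mul]
  congr 1
  refine Finset.prod_congr rfl fun j hj => ?_
  rw [hne j (Finset.ne_of_mem_erase hj), Measure.restrict_apply_univ]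

/-- The log-likelihood ratio of the Bernoulli distributions with means `p` and `q`. -/
noncomputable def bernoulliLLR (p q : ℝ) (r : unitInterval) : ℝ :=
  if r = 1 then Real.log (p / q) else Real.log ((1 - p) / (1 - q))

@[fun_prop]
theorem measurable_bernoulliLLR (p q : ℝ) : Measurable (bernoulliLLR p q) :=
  Measurable.ite (measurableSet_singleton 1) measurable_const measurable_const

theorem ofReal_mul_ofReal_exp_neg_log {x y : ℝ} (hx : 0 < x) (hy : 0 < y) :
    ENNReal.ofReal x * ENNReal.ofReal (Real.exp (-Real.log (x / y))) = ENNReal.ofReal y := by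
  rw [← ENNReal.ofReal_mul hx.le, Real.exp_neg, Real.exp_log (div_pos hx hy)]
  congr 1
  field_simp

theorem bernoulliReward_eq_withDensity {p q : unitInterval} (hp : (p : ℝ) ∈ Set.Ioo (0 : ℝ) 1)
    (hq : (q : ℝ) ∈ Set.Ioo (0 : ℝ) 1) :
    (bernoulliReward q : Measure unitInterval) = (bernoulliReward p : Measure unitInterval).withDensity
      fun r => ENNReal.ofReal (Real.exp (-bernoulliLLR p q r)) := by
  refine Measure.ext_of_lintegral _ fun f hf => ?_
  rw [lintegral_withDensity_eq_lintegral_mul _ (by fun_prop) hf, lintegral_bernoulliReward,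
    lintegral_bernoulliReward]
  simp only [Pi.mul_apply, bernoulliLLR, if_true, zero_ne_one, if_false]
  rw [← mul_assoc, ← mul_assoc, ofReal_mul_ofReal_exp_neg_log hp.1 hq.1,
    ofReal_mul_ofReal_exp_neg_log (sub_pos.2 hp.2) (sub_pos.2 hq.2)]

/-- The Kullback–Leibler divergence is at most the chi-squared divergence. -/
theorem bernoulli_kl_le {p q : ℝ} (hp : p ∈ Set.Ioo (0 : ℝ) 1) (hq : q ∈ Set.Ioo (0 : ℝ) 1) :
    p * Real.log (p / q) + (1 - p) * Real.log ((1 - p) / (1 - q)) ≤ (p - q) ^ 2 / (q * (1 - q)) := by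
  obtain ⟨hp0, hp1⟩ := hp
  obtain ⟨hq0, hq1⟩ := hq
  have hp1' := sub_pos.2 hp1
  have hq1' := sub_pos.2 hq1
  have h1 := Real.log_le_sub_one_of_pos (div_pos hp0 hq0)
  have h2 := Real.log_le_sub_one_of_pos (div_pos hp1' hq1')
  calc _ ≤ p * (p / q - 1) + (1 - p) * ((1 - p) / (1 - q) - 1) := by gcongr
    _ = _ := by field_simp; ring

section Density

variable {S A H : ℕ} {P0 P0' : stdSimplex ℝ (Fin S)}
  {P P' : Fin H → Fin S → Fin A → stdSimplex ℝ (Fin S)}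
  {μ : Fin H → Fin S → Fin A → unitInterval} {hbar : Fin H} {s : Fin S} {b : Fin A}

/-- The mean rewards `μ`, with the one at `(hbar, s, b)` replaced by `q`. -/
def updateMean (μ : Fin H → Fin S → Fin A → unitInterval) (hbar : Fin H) (s : Fin S) (b : Fin A)
    (q : unitInterval) : Fin H → Fin S → Fin A → unitInterval :=
  fun h t a => if h = hbar ∧ t = s ∧ a = b then q else μ h t a

/-- The log-likelihood ratio of an episode when the mean reward at `(hbar, s, b)` is changed from
`p` to `q`. -/
noncomputable def episodeLLR (hbar : Fin H) (s : Fin S) (b : Fin A) (p q : ℝ)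
    (e : Episode S A H) : ℝ :=
  if (e hbar).1 = s ∧ (e hbar).2.1 = b then bernoulliLLR p q (e hbar).2.2 else 0

@[fun_prop]
theorem measurable_episodeLLR (hbar : Fin H) (s : Fin S) (b : Fin A) (p q : ℝ) :
    Measurable (episodeLLR hbar s b p q) := by
  refine Measurable.ite ?_ (by fun_prop) measurable_const
  exact (measurableSet_eq_fun (by fun_prop) measurable_const).inter
    (measurableSet_eq_fun (by fun_prop) measurable_const)

/-- Conditionally on the state-action path only the reward at `hbar` can change, and only if the
path goes through (s, b). The path probabilities themselves are compared by `hpath`. Taking c = 1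
and equal kernels gives the plain perturbation; c < 1 accommodates smoothing. -/
theorem smul_withDensity_episodeLaw_le {c : ℝ} (hc : 0 ≤ c)
    (hpath : ∀ π p, c * MDP.pathProb P0 P π p ≤ MDP.pathProb P0' P' π p) {q : unitInterval}
    (hp : (μ hbar s b : ℝ) ∈ Set.Ioo (0 : ℝ) 1) (hq : (q : ℝ) ∈ Set.Ioo (0 : ℝ) 1)
    (π : Policy S A H) :
    ENNReal.ofReal c • ((bernoulliMDP P0 P μ).episodeLaw π).withDensity
        (fun e => ENNReal.ofReal (Real.exp (-episodeLLR hbar s b (μ hbar s b) q e))) ≤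
      (bernoulliMDP P0' P' (updateMean μ hbar s b q)).episodeLaw π := by
  have mℓ : Measurable fun e : Episode S A H =>
      ENNReal.ofReal (Real.exp (-episodeLLR hbar s b (μ hbar s b) q e)) := by fun_prop
  refine Measure.le_iff.2 fun B hB => ?_
  have mf : Measurable (B.indicator (1 : Episode S A H → ℝ≥0∞)) := measurable_one.indicator hB
  rw [← lintegral_indicator_one hB, ← lintegral_indicator_one hB, lintegral_smul_measure,
    lintegral_withDensity_eq_lintegral_mul _ mℓ mf, MDP.lintegral_episodeLaw _ _ mf,
    MDP.lintegral_episodeLaw _ _ (mℓ.mul mf), smul_eq_mul, Finset.mul_sum]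
  refine Finset.sum_le_sum fun p _ => ?_
  rw [← mul_assoc, ← ENNReal.ofReal_mul hc]
  refine mul_le_mul' (ENNReal.ofReal_le_ofReal (hpath π p)) (le_of_eq ?_)
  set g : unitInterval → ℝ≥0∞ := fun x => if (p hbar).1 = s ∧ (p hbar).2 = b then
    ENNReal.ofReal (Real.exp (-bernoulliLLR (μ hbar s b) q x)) else 1 with hg
  have mg : Measurable g := by
    by_cases h : (p hbar).1 = s ∧ (p hbar).2 = b
    · simp only [hg, h, and_self, if_true]; fun_prop
    · simp only [hg, h, if_false]; fun_prop
  have hR : (Measure.pi fun h => ((bernoulliMDP P0' P' (updateMean μ hbar s b q)).R h (p h).1 (p h).2 :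
      Measure unitInterval)) = (Measure.pi fun h => ((bernoulliMDP P0 P μ).R h (p h).1 (p h).2 :
      Measure unitInterval)).withDensity fun r => g (r hbar) := by
    refine pi_eq_withDensity (i := hbar) mg (fun h hh => ?_) ?_
    · simp [bernoulliMDP, updateMean, hh]
    · by_cases h : (p hbar).1 = s ∧ (p hbar).2 = b
      · simp only [hg, h, bernoulliMDP, updateMean, and_self, if_true]
        exact bernoulliReward_eq_withDensity hp hq
      · simp only [hg, h, bernoulliMDP, updateMean, and_false, if_false]
        exact withDensity_one.symm
  have mB : Measurable fun r : Fin H → unitInterval =>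
      B.indicator (1 : Episode S A H → ℝ≥0∞) (fun h => ((p h).1, (p h).2, r h)) :=
    mf.comp (by fun_prop)
  have mg' : Measurable fun r : Fin H → unitInterval => g (r hbar) :=
    mg.comp (measurable_pi_apply hbar)
  rw [hR, lintegral_withDensity_eq_lintegral_mul _ mg' mB]
  refine lintegral_congr fun r => ?_
  simp only [Pi.mul_apply, episodeLLR, hg]
  congr 1
  split_ifs <;> simp

theorem abs_episodeLLR_le (p q : ℝ) (e : Episode S A H) :
    |episodeLLR hbar s b p q e| ≤ |Real.log (p / q)| + |Real.log ((1 - p) / (1 - q))| := by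
  unfold episodeLLR bernoulliLLR
  have h1 := abs_nonneg (Real.log (p / q))
  have h2 := abs_nonneg (Real.log ((1 - p) / (1 - q)))
  split_ifs
  · linarith
  · linarith
  · rw [abs_zero]; linarith

theorem map_episodeLaw_step (M : MDP S A H) (π : Policy S A H) (h : Fin H) :
    (M.episodeLaw π).map (fun e => e h) = ∑ x : Fin S × Fin A,
      ENNReal.ofReal (MDP.occ M.P0 M.P π h x.1 * π h x.1 x.2) •
        (M.R h x.1 x.2 : Measure unitInterval).map fun r => (x.1, x.2, r) := by
  refine Measure.ext_of_lintegral _ fun f hf => ?_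
  rw [lintegral_map hf (by fun_prop), MDP.lintegral_episodeLaw_step M π h hf,
    lintegral_finsetSum_measure, Fintype.sum_prod_type]
  refine Finset.sum_congr rfl fun s _ => Finset.sum_congr rfl fun a _ => ?_
  rw [lintegral_smul_measure, lintegral_map hf (by fun_prop), smul_eq_mul]

theorem integral_episodeLLR (π : Policy S A H) (p q : ℝ) :
    ∫ e, episodeLLR hbar s b p q e ∂(bernoulliMDP P0 P μ).episodeLaw π =
      ((bernoulliMDP P0 P μ).visit π hbar s b).toReal * (μ hbar s b * Real.log (p / q) +
        (1 - μ hbar s b) * Real.log ((1 - p) / (1 - q))) := by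
  set f : Fin S × Fin A × unitInterval → ℝ :=
    fun x => if x.1 = s ∧ x.2.1 = b then bernoulliLLR p q x.2.2 else 0 with hf
  have mf : Measurable f := by
    refine Measurable.ite ?_ (by fun_prop) measurable_const
    exact (measurableSet_eq_fun (by fun_prop) measurable_const).inter
      (measurableSet_eq_fun (by fun_prop) measurable_const)
  have bf : ∀ x, ‖f x‖ ≤ |Real.log (p / q)| + |Real.log ((1 - p) / (1 - q))| :=
    fun x => abs_episodeLLR_le (hbar := hbar) p q (fun _ => x)
  have h1 : ∫ e, episodeLLR hbar s b p q e ∂(bernoulliMDP P0 P μ).episodeLaw π =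
      ∫ x, f x ∂((bernoulliMDP P0 P μ).episodeLaw π).map (fun e => e hbar) := by
    have me : Measurable fun e : Episode S A H => e hbar := by fun_prop
    rw [integral_map me.aemeasurable mf.aestronglyMeasurable]; rfl
  rw [h1, map_episodeLaw_step, integral_finsetSum_measure]
  · rw [Finset.sum_eq_single (s, b)]
    · rw [integral_smul_measure, integral_map (by fun_prop) mf.aestronglyMeasurable, MDP.visit_eq]
      simp only [hf, and_self, if_true, smul_eq_mul]
      congr 1
      refine (integral_bernoulliReward _ _).trans ?_
      simp [bernoulliLLR]
    · rintro ⟨t, a⟩ _ hx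
      rw [integral_smul_measure, integral_map (by fun_prop) mf.aestronglyMeasurable]
      have : ¬ (t = s ∧ a = b) := fun h => hx (by rw [h.1, h.2])
      simp [hf, this]
    · simp
  · intro x _
    refine Integrable.smul_measure ?_ ENNReal.ofReal_ne_top
    have : IsProbabilityMeasure (((bernoulliMDP P0 P μ).R hbar x.1 x.2 :
        Measure unitInterval).map fun r => (x.1, x.2, r)) :=
      Measure.isProbabilityMeasure_map (by fun_prop)
    exact Integrable.of_bound mf.aestronglyMeasurable _ (Filter.Eventually.of_forall bf)

end Density

/-! ### Smoothing the transitions -/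

section Smoothing

variable {S A H : ℕ}

/-- The mixture `(1 - ε) p + ε U` with the uniform distribution `U`. -/
noncomputable def smooth (hS : 0 < S) (ε : unitInterval) (p : stdSimplex ℝ (Fin S)) :
    stdSimplex ℝ (Fin S) :=
  ⟨fun i => (1 - ε) * p i + ε * (S : ℝ)⁻¹, fun i =>
    add_nonneg (mul_nonneg (sub_nonneg.2 ε.2.2) (p.2.1 i)) (mul_nonneg ε.2.1 (by positivity)), by
    have h1 : ∑ i, p i = 1 := p.2.2
    have h2 : (S : ℝ) ≠ 0 := by positivity
    rw [Finset.sum_add_distrib, ← Finset.mul_sum, h1]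
    simp [mul_comm (ε : ℝ), h2]⟩

theorem smooth_apply (hS : 0 < S) (ε : unitInterval) (p : stdSimplex ℝ (Fin S)) (i : Fin S) :
    smooth hS ε p i = (1 - ε) * p i + ε * (S : ℝ)⁻¹ := rfl

theorem mul_le_smooth (hS : 0 < S) (ε : unitInterval) (p : stdSimplex ℝ (Fin S)) (i : Fin S) :
    (1 - ε) * p i ≤ smooth hS ε p i := by
  rw [smooth_apply]
  exact le_add_of_nonneg_right (mul_nonneg ε.2.1 (by positivity))

theorem le_smooth (hS : 0 < S) (ε : unitInterval) (p : stdSimplex ℝ (Fin S)) (i : Fin S) :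
    ε * (S : ℝ)⁻¹ ≤ smooth hS ε p i := by
  rw [smooth_apply]
  exact le_add_of_nonneg_left (mul_nonneg (sub_nonneg.2 ε.2.2) (p.2.1 i))

/-- A path has H state draws, each retaining at least a fraction 1 - ε of its probability. An
inequality suffices: the smoothed law may charge paths that the original one does not. -/
theorem pow_mul_pathProb_le (hS : 0 < S) (ε : unitInterval) (P0 : stdSimplex ℝ (Fin S))
    (P : Fin H → Fin S → Fin A → stdSimplex ℝ (Fin S)) (π : Policy S A H)
    (p : Fin H → Fin S × Fin A) :
    (1 - ε : ℝ) ^ H * MDP.pathProb P0 P π p ≤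
      MDP.pathProb (smooth hS ε P0) (fun h s a => smooth hS ε (P h s a)) π p := by
  unfold MDP.pathProb
  have hε : (0 : ℝ) ≤ 1 - ε := sub_nonneg.2 ε.2.2
  have h0 : ∀ h, 0 ≤ MDP.stateProb P0 P p h := by
    intro h
    unfold MDP.stateProb
    split_ifs
    · exact P0.2.1 _
    · exact (P _ _ _).2.1 _
  have e : (1 - ε : ℝ) ^ H = ∏ _h : Fin H, (1 - ε : ℝ) := by simp
  rw [e, ← Finset.prod_mul_distrib]
  refine Finset.prod_le_prod (fun h _ => mul_nonneg hε (mul_nonneg (h0 h) ((π h _).2.1 _)))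
    fun h _ => ?_
  rw [← mul_assoc]
  refine mul_le_mul_of_nonneg_right ?_ ((π h _).2.1 _)
  unfold MDP.stateProb
  split_ifs
  · exact mul_le_smooth hS ε _ _
  · exact mul_le_smooth hS ε _ _

/-- The occupancy is the initial law or an average of kernel entries, all of which are at least `c`.
-/
theorem le_occ {P0 : stdSimplex ℝ (Fin S)} {P : Fin H → Fin S → Fin A → stdSimplex ℝ (Fin S)}
    {c : ℝ} (h0 : ∀ s, c ≤ P0 s) (hP : ∀ h s a s', c ≤ P h s a s') (π : Policy S A H) (h : Fin H)
    (s : Fin S) : c ≤ MDP.occ P0 P π h s := by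
  rcases h with ⟨_ | n, hn⟩
  · exact h0 s
  · have e := MDP.occ_succ P0 P π ⟨n, by omega⟩ s
    simp only at e ⊢
    rw [e]
    have h1 : ∑ t, ∑ a, MDP.occ P0 P π n t * π ⟨n, by omega⟩ t a = 1 := by
      simp_rw [← Finset.mul_sum, MDP.sum_policy, mul_one]
      exact MDP.sum_occ P0 P π n (by omega)
    calc c = ∑ t, ∑ a, MDP.occ P0 P π n t * π ⟨n, by omega⟩ t a * c := by
          simp_rw [← Finset.sum_mul, h1, one_mul]
      _ ≤ _ := Finset.sum_le_sum fun t _ => Finset.sum_le_sum fun a _ =>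
        mul_le_mul_of_nonneg_left (hP _ t a s)
          (mul_nonneg (MDP.occ_nonneg _ _ _ _ _) (MDP.policy_nonneg π _ t a))

end Smoothing

/-! ### The stopping time and the probability of mistakes -/

namespace Algorithm

variable {S A H : ℕ}

/-- What was known after `j ≤ k` rounds. -/
def truncate {k : ℕ} (j : Fin (k + 1)) (x : Info S A H k) : Info S A H j :=
  (fun i => x.1 ⟨i, by omega⟩, if h : j.val < k then (x.1 ⟨j, h⟩).1 else x.2)

theorem truncate_info {k : ℕ} (j : Fin (k + 1)) (ω : ℕ → unitInterval × Episode S A H) :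
    truncate j (info k ω) = info j ω := by
  unfold truncate info
  congr 1
  split_ifs with h
  · rfl
  · have : j.val = k := by omega
    rw [this]

theorem measurable_truncate {k : ℕ} (j : Fin (k + 1)) :
    Measurable (truncate (S := S) (A := A) (H := H) j) := by
  unfold truncate
  refine Measurable.prodMk (by fun_prop) ?_
  split_ifs <;> fun_prop

/-- The algorithm has not stopped after at most `k` rounds. -/
def aliveSet (alg : Algorithm S A H) (k : ℕ) : Set (Info S A H k) :=
  {x | ∀ j : Fin (k + 1), truncate j x ∉ alg.halt j}

/-- The algorithm stops after exactly `k` rounds. -/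
def stopSet (alg : Algorithm S A H) (k : ℕ) : Set (Info S A H k) :=
  {x | truncate (Fin.last k) x ∈ alg.halt k ∧ ∀ j : Fin k, truncate j.castSucc x ∉ alg.halt j}

theorem measurableSet_aliveSet (alg : Algorithm S A H) (k : ℕ) :
    MeasurableSet (alg.aliveSet k) := by
  have : alg.aliveSet k = ⋂ j : Fin (k + 1), (truncate j ⁻¹' alg.halt j)ᶜ := by
    ext x; simp [aliveSet]
  rw [this]
  exact MeasurableSet.iInter fun j => (measurable_truncate j (alg.measurableSet_halt j)).compl

theorem measurableSet_stopSet (alg : Algorithm S A H) (k : ℕ) :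
    MeasurableSet (alg.stopSet k) := by
  have : alg.stopSet k = (truncate (Fin.last k) ⁻¹' alg.halt k) ∩
      ⋂ j : Fin k, (truncate j.castSucc ⁻¹' alg.halt j)ᶜ := by
    ext x; simp [stopSet]
  rw [this]
  exact (measurable_truncate (Fin.last k) (alg.measurableSet_halt k)).inter
    (MeasurableSet.iInter fun j => (measurable_truncate j.castSucc (alg.measurableSet_halt j)).compl)

theorem lt_stopTime_iff (alg : Algorithm S A H) (k : ℕ) (ω : ℕ → unitInterval × Episode S A H) :
    (k : ℕ∞) < alg.stopTime ω ↔ info k ω ∈ alg.aliveSet k := by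
  have h1 : (k : ℕ∞) < alg.stopTime ω ↔ ((k + 1 : ℕ) : ℕ∞) ≤ alg.stopTime ω := by
    rw [Nat.cast_add, Nat.cast_one]
    exact (ENat.add_one_le_iff (ENat.natCast_ne_top k)).symm
  rw [h1]
  unfold stopTime aliveSet
  simp only [le_iInf_iff, Nat.cast_le, Set.mem_ofPred_eq, truncate_info]
  constructor
  · intro h j hj
    have := h j hj
    omega
  · intro h i hi
    by_contra hlt
    exact h ⟨i, by omega⟩ hi

theorem le_stopTime_iff (alg : Algorithm S A H) (k : ℕ) (ω : ℕ → unitInterval × Episode S A H) :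
    (k : ℕ∞) ≤ alg.stopTime ω ↔ ∀ j < k, info j ω ∉ alg.halt j := by
  unfold stopTime
  simp only [le_iInf_iff, Nat.cast_le]
  constructor
  · intro h j hj hh
    have := h j hh
    omega
  · intro h i hi
    by_contra hlt
    exact h i (by omega) hi

theorem stopTime_eq_iff (alg : Algorithm S A H) (k : ℕ) (ω : ℕ → unitInterval × Episode S A H) :
    alg.stopTime ω = k ↔ info k ω ∈ alg.stopSet k := by
  unfold stopSet
  simp only [Set.mem_ofPred_eq, truncate_info]
  rw [le_antisymm_iff, le_stopTime_iff, ← not_lt, lt_stopTime_iff]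
  unfold aliveSet
  simp only [Set.mem_ofPred_eq, truncate_info]
  constructor
  · rintro ⟨h1, h2⟩
    refine ⟨?_, fun j => h2 j j.isLt⟩
    by_contra hk
    refine h1 fun j => ?_
    rcases Nat.lt_or_ge j.val k with hj | hj
    · exact h2 _ hj
    · have : j.val = k := by omega
      rw [this]
      exact hk
  · rintro ⟨h1, h2⟩
    exact ⟨fun h => h (Fin.last k) h1, fun j hj => h2 ⟨j, hj⟩⟩

/-- Tail-sum formula for the expectation: being alive after `k` rounds means that the stopping time
exceeds `k`. -/
theorem tsum_aliveSet_le (alg : Algorithm S A H) (M : MDP S A H) :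
    ∑' k, alg.law M (info k ⁻¹' alg.aliveSet k) ≤ alg.expectedEpisodes M := by
  have hm : ∀ k, MeasurableSet (info k ⁻¹' alg.aliveSet k) := fun k =>
    measurable_info k (alg.measurableSet_aliveSet k)
  simp_rw [← lintegral_indicator_one (hm _)]
  rw [← lintegral_tsum fun k => (measurable_one.indicator (hm k)).aemeasurable]
  refine lintegral_mono fun ω => ?_
  cases h : alg.stopTime ω with
  | top => simp
  | coe n =>
    have h1 : ∀ k ∉ Finset.range n, (info k ⁻¹' alg.aliveSet k).indicator
        (1 : (ℕ → unitInterval × Episode S A H) → ℝ≥0∞) ω = 0 := by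
      intro k hk
      refine Set.indicator_of_notMem (fun hmem => hk ?_) _
      have := (alg.lt_stopTime_iff k ω).2 hmem
      rw [h] at this
      simpa using this
    rw [tsum_eq_sum h1]
    refine (Finset.sum_le_sum fun k _ => Set.indicator_le_self' (fun _ _ => zero_le) ω).trans ?_
    simp

/-- On an MDP on which the algorithm is correct, it rarely stops with a suboptimal policy. -/
theorem sum_law_stopSet_inter_le {alg : Algorithm S A H} {N : MDP S A H} {δ : ℝ} (hδ0 : 0 ≤ δ)
    (hδ1 : δ ≤ 1)
    (hN : ENNReal.ofReal (1 - δ) ≤ alg.law N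
      {ω | ∃ k : ℕ, alg.stopTime ω = k ∧ N.optValue - N.value (alg.output k (info k ω)) ≤ 0})
    {B : (k : ℕ) → Set (Info S A H k)} (mB : ∀ k, MeasurableSet (B k))
    (hB : ∀ k, ∀ x ∈ B k, 0 < N.optValue - N.value (alg.output k x)) (n : ℕ) :
    ∑ k ∈ Finset.range n, alg.law N (info k ⁻¹' (alg.stopSet k ∩ B k)) ≤ ENNReal.ofReal δ := by
  set E := {ω | ∃ k : ℕ, alg.stopTime ω = k ∧
    N.optValue - N.value (alg.output k (info k ω)) ≤ 0} with hE
  have hm : ∀ k, MeasurableSet (info k ⁻¹' (alg.stopSet k ∩ B k)) := fun k =>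
    measurable_info k ((alg.measurableSet_stopSet k).inter (mB k))
  have hst : ∀ k ω, ω ∈ info k ⁻¹' (alg.stopSet k ∩ B k) → alg.stopTime ω = k := fun k ω h =>
    (alg.stopTime_eq_iff k ω).2 h.1
  rw [← measure_biUnion_finset _ fun k _ => hm k]
  · set U := ⋃ k ∈ Finset.range n, info k ⁻¹' (alg.stopSet k ∩ B k) with hU
    have hd : Disjoint E U := by
      rw [Set.disjoint_left]
      rintro ω ⟨k, hk, hv⟩ hu
      simp only [hU, Set.mem_iUnion] at hu
      obtain ⟨j, _, hj⟩ := hu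
      have h1 : (k : ℕ∞) = j := hk.symm.trans (hst j ω hj)
      have h2 : k = j := by exact_mod_cast h1
      subst h2
      exact absurd hv (not_le.2 (hB k _ hj.2))
    have mU : MeasurableSet U := Finset.measurableSet_biUnion _ fun k _ => hm k
    -- Additivity needs only `U` measurable, so the measurability of the success event `E` is not
    -- required.
    have h1 : alg.law N E + alg.law N U ≤ 1 := by
      rw [← measure_union hd mU]; exact prob_le_one
    have h2 : ENNReal.ofReal (1 - δ) + alg.law N U ≤ ENNReal.ofReal (1 - δ) + ENNReal.ofReal δ := by
      rw [← ENNReal.ofReal_add (by linarith) hδ0, sub_add_cancel, ENNReal.ofReal_one]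
      exact (add_le_add_left hN _).trans h1
    exact (ENNReal.add_le_add_iff_left ENNReal.ofReal_ne_top).1 h2
  · intro i _ j _ hij
    refine Set.disjoint_left.2 fun ω hi hj => hij ?_
    have h1 : (i : ℕ∞) = j := (hst i ω hi).symm.trans (hst j ω hj)
    exact_mod_cast h1

variable {M : MDP S A H} {ℓ : Episode S A H → ℝ≥0∞}

/-- The previous bound, transported to an MDP `M` that is a limit of MDPs on which the algorithm is
correct. -/
theorem sum_lintegral_stopSet_inter_le {alg : Algorithm S A H} {δ : ℝ} (hδ0 : 0 ≤ δ)
    (hδ1 : δ ≤ 1) (hℓ : Measurable ℓ) {B : (k : ℕ) → Set (Info S A H k)}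
    (mB : ∀ k, MeasurableSet (B k))
    (hN : ∀ c : ℝ≥0∞, c < 1 → ∃ N : MDP S A H,
      (∀ π, c • (M.episodeLaw π).withDensity ℓ ≤ N.episodeLaw π) ∧
      ENNReal.ofReal (1 - δ) ≤ alg.law N
        {ω | ∃ k : ℕ, alg.stopTime ω = k ∧ N.optValue - N.value (alg.output k (info k ω)) ≤ 0} ∧
      ∀ k, ∀ x ∈ B k, 0 < N.optValue - N.value (alg.output k x)) (n : ℕ) :
    ∑ k ∈ Finset.range n, ∫⁻ ω, (alg.stopSet k ∩ B k).indicator 1 (info k ω) *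
      likelihood ℓ (rounds k ω) ∂alg.law M ≤ ENNReal.ofReal δ := by
  set X := ∑ k ∈ Finset.range n, ∫⁻ ω, (alg.stopSet k ∩ B k).indicator 1 (info k ω) *
      likelihood ℓ (rounds k ω) ∂alg.law M with hX
  -- Each term loses c^k, which is at least c^n. With `n` fixed and `X` independent of `c`, letting
  -- c increase to 1 removes the loss.
  have key : ∀ c : ℝ≥0∞, c < 1 → c ^ n * X ≤ ENNReal.ofReal δ := by
    intro c hc
    obtain ⟨N, h1, h2, h3⟩ := hN c hc
    refine le_trans ?_ (sum_law_stopSet_inter_le hδ0 hδ1 h2 mB h3 n)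
    rw [hX, Finset.mul_sum]
    refine Finset.sum_le_sum fun k hk => ?_
    have hm : MeasurableSet (alg.stopSet k ∩ B k) := (alg.measurableSet_stopSet k).inter (mB k)
    have h4 := lintegral_info_likelihood_le alg hℓ h1 k
      (f := (alg.stopSet k ∩ B k).indicator 1) (measurable_one.indicator hm)
    have h5 : ∫⁻ ω, (alg.stopSet k ∩ B k).indicator 1 (info k ω) ∂alg.law N =
        alg.law N (info k ⁻¹' (alg.stopSet k ∩ B k)) := by
      rw [← lintegral_indicator_one (measurable_info k hm)]
      rfl
    rw [h5] at h4
    refine le_trans (mul_le_mul_left ?_ _) h4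
    exact pow_le_pow_right_of_le_one' hc.le (Finset.mem_range.1 hk).le
  have ht : Filter.Tendsto (fun c : ℝ≥0∞ => c ^ n * X) (nhdsWithin 1 (Set.Iio 1)) (nhds (1 ^ n * X)) :=
    (ENNReal.Tendsto.mul_const ((ENNReal.continuous_pow n).tendsto 1) (Or.inl (by simp))).mono_left
      nhdsWithin_le_nhds
  rw [one_pow, one_mul] at ht
  have : (nhdsWithin (1 : ℝ≥0∞) (Set.Iio 1)).NeBot := nhdsLT_neBot_of_exists_lt ⟨0, one_pos⟩
  refine le_of_tendsto ht ?_
  filter_upwards [self_mem_nhdsWithin] with c hc using key c hc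

/-- The total mass of the likelihood ratio at the stopping time, truncated at `n`. -/
theorem sum_lintegral_stopSet_add_le {alg : Algorithm S A H} {N : MDP S A H} (hℓ : Measurable ℓ)
    (hN : ∀ π, (M.episodeLaw π).withDensity ℓ ≤ N.episodeLaw π) (n : ℕ) :
    ∑ k ∈ Finset.range n, ∫⁻ ω, (alg.stopSet k).indicator 1 (info k ω) *
      likelihood ℓ (rounds k ω) ∂alg.law M +
    ∫⁻ ω, (alg.stopSet n ∪ alg.aliveSet n).indicator 1 (info n ω) *
      likelihood ℓ (rounds n ω) ∂alg.law M ≤ 1 := by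
  have hm := fun k => alg.measurableSet_stopSet k
  have hm' : MeasurableSet (alg.stopSet n ∪ alg.aliveSet n) :=
    (hm n).union (alg.measurableSet_aliveSet n)
  have key : ∀ k (T : Set (Info S A H k)), MeasurableSet T →
      ∫⁻ ω, T.indicator 1 (info k ω) * likelihood ℓ (rounds k ω) ∂alg.law M ≤
        alg.law N (info k ⁻¹' T) := by
    intro k T hT
    have h4 := lintegral_info_likelihood_le (c := 1) alg hℓ (by simpa using hN) k
      (f := T.indicator 1) (measurable_one.indicator hT)
    rw [one_pow, one_mul] at h4
    refine h4.trans (le_of_eq ?_)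
    rw [← lintegral_indicator_one (measurable_info k hT)]
    rfl
  refine (add_le_add (Finset.sum_le_sum fun k _ => key k _ (hm k)) (key n _ hm')).trans ?_
  have hst : ∀ k ω, ω ∈ info k ⁻¹' (alg.stopSet k) → alg.stopTime ω = k := fun k ω h =>
    (alg.stopTime_eq_iff k ω).2 h
  rw [← measure_biUnion_finset _ fun k _ => measurable_info k (hm k), ← measure_union _
    (measurable_info n hm')]
  · exact prob_le_one
  · rw [Set.disjoint_left]
    intro ω h1 h2
    simp only [Set.mem_iUnion] at h1
    obtain ⟨j, hj, hj'⟩ := h1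
    have hj := Finset.mem_range.1 hj
    have h3 := hst j ω hj'
    have h4 : (n : ℕ∞) ≤ alg.stopTime ω := by
      rcases h2 with h2 | h2
      · exact (hst n ω h2).ge
      · exact ((alg.lt_stopTime_iff n ω).2 h2).le
    rw [h3, Nat.cast_le] at h4
    omega
  · intro i _ j _ hij
    refine Set.disjoint_left.2 fun ω hi hj => hij ?_
    have h1 : (i : ℕ∞) = j := (hst i ω hi).symm.trans (hst j ω hj)
    exact_mod_cast h1

end Algorithm

/-! ### The transportation inequality at the stopping time -/

namespace Algorithm

variable {S A H : ℕ} {alg : Algorithm S A H} {M : MDP S A H} {Y : Episode S A H → ℝ} {b : ℝ}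

/-- The sum of `Y` over the episodes that are played before the algorithm stops and before time
`n`. -/
noncomputable def stoppedSum (alg : Algorithm S A H) (Y : Episode S A H → ℝ) (n : ℕ)
    (ω : ℕ → unitInterval × Episode S A H) : ℝ :=
  ∑ k ∈ Finset.range n, (alg.aliveSet k).indicator (fun _ => Y (ω k).2) (info k ω)

theorem measurable_aliveSet_indicator (alg : Algorithm S A H) (hY : Measurable Y) (k : ℕ) :
    Measurable fun p : Info S A H k × Episode S A H =>
      (alg.aliveSet k).indicator (fun _ => Y p.2) p.1 := by
  classical
  simp only [Set.indicator_apply]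
  exact Measurable.ite (measurable_fst (alg.measurableSet_aliveSet k)) (by fun_prop)
    measurable_const

theorem measurable_stoppedSum (alg : Algorithm S A H) (hY : Measurable Y) (n : ℕ) :
    Measurable (alg.stoppedSum Y n) := by
  unfold stoppedSum
  refine Finset.measurable_sum _ fun k _ => ?_
  exact (measurable_aliveSet_indicator alg hY k).comp
    (g := fun p : Info S A H k × Episode S A H =>
      (alg.aliveSet k).indicator (fun _ => Y p.2) p.1)
    (f := fun ω => (info k ω, (ω k).2)) (by fun_prop)

theorem abs_indicator_le (hb : ∀ e, |Y e| ≤ b) (k : ℕ) (p : Info S A H k × Episode S A H) :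
    |(alg.aliveSet k).indicator (fun _ => Y p.2) p.1| ≤ b := by
  classical
  rw [Set.indicator_apply]
  split_ifs
  · exact hb _
  · rw [abs_zero]; exact (abs_nonneg _).trans (hb p.2)

theorem abs_stoppedSum_le (hb : ∀ e, |Y e| ≤ b) (n : ℕ)
    (ω : ℕ → unitInterval × Episode S A H) : |alg.stoppedSum Y n ω| ≤ n * b := by
  unfold stoppedSum
  refine (Finset.abs_sum_le_sum_abs _ _).trans ?_
  refine (Finset.sum_le_sum fun k _ => abs_indicator_le hb k (info k ω, (ω k).2)).trans ?_
  simp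

theorem likelihood_rounds_eq (k : ℕ) (ω : ℕ → unitInterval × Episode S A H) :
    likelihood (fun e => ENNReal.ofReal (Real.exp (-Y e))) (rounds k ω) =
      ENNReal.ofReal (Real.exp (-∑ i ∈ Finset.range k, Y (ω i).2)) := by
  unfold likelihood rounds
  rw [← Finset.sum_neg_distrib, Real.exp_sum, ENNReal.ofReal_prod_of_nonneg
    fun _ _ => (Real.exp_pos _).le]
  exact Fin.prod_univ_eq_prod_range (fun i => ENNReal.ofReal (Real.exp (-Y (ω i).2))) k

/-- Episode `i`, counted from 0, is played exactly when `i` is less than the stopping time. The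
second alternative covers runs cut off at the horizon `n`. -/
theorem stoppedSum_eq {n k : ℕ} (hk : k ≤ n) {ω : ℕ → unitInterval × Episode S A H}
    (h : alg.stopTime ω = k ∨ k = n ∧ (n : ℕ∞) ≤ alg.stopTime ω) :
    alg.stoppedSum Y n ω = ∑ i ∈ Finset.range k, Y (ω i).2 := by
  unfold stoppedSum
  have hlt : ∀ i < n, info i ω ∈ alg.aliveSet i ↔ i < k := by
    intro i hi
    rw [← lt_stopTime_iff]
    rcases h with h | ⟨rfl, h⟩
    · rw [h, Nat.cast_lt]
    · exact ⟨fun _ => hi, fun _ => lt_of_lt_of_le (by exact_mod_cast hi) h⟩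
  rw [← Finset.sum_subset (Finset.range_subset_range.2 hk)]
  · refine Finset.sum_congr rfl fun i hi => ?_
    have hi := Finset.mem_range.1 hi
    rw [Set.indicator_of_mem ((hlt i (by omega)).2 hi)]
  · intro i hi hik
    rw [Finset.mem_range] at hi hik
    exact Set.indicator_of_notMem (fun hm => hik ((hlt i hi).1 hm)) _

/-- The event that the algorithm stops before time `n` with information in `C`. -/
def stopEvent (alg : Algorithm S A H) (C : (k : ℕ) → Set (Info S A H k)) (n : ℕ) :
    Set (ℕ → unitInterval × Episode S A H) :=
  ⋃ k ∈ Finset.range n, info k ⁻¹' (alg.stopSet k ∩ C k)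

theorem measurableSet_stopEvent {C : (k : ℕ) → Set (Info S A H k)}
    (mC : ∀ k, MeasurableSet (C k)) (n : ℕ) : MeasurableSet (alg.stopEvent C n) :=
  Finset.measurableSet_biUnion _ fun k _ =>
    measurable_info k ((alg.measurableSet_stopSet k).inter (mC k))

theorem lintegral_stopEvent_le {C : (k : ℕ) → Set (Info S A H k)} (hY : Measurable Y)
    (mC : ∀ k, MeasurableSet (C k)) (n : ℕ) :
    ∫⁻ ω, (alg.stopEvent C n).indicator 1 ω * ENNReal.ofReal (Real.exp (-alg.stoppedSum Y n ω))
        ∂alg.law M ≤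
      ∑ k ∈ Finset.range n, ∫⁻ ω, (alg.stopSet k ∩ C k).indicator 1 (info k ω) *
        likelihood (fun e => ENNReal.ofReal (Real.exp (-Y e))) (rounds k ω) ∂alg.law M := by
  have mℓ : Measurable fun e => ENNReal.ofReal (Real.exp (-Y e)) := by fun_prop
  have mf : ∀ k, Measurable fun ω =>
      (alg.stopSet k ∩ C k).indicator (1 : Info S A H k → ℝ≥0∞) (info k ω) *
      likelihood (fun e => ENNReal.ofReal (Real.exp (-Y e))) (rounds k ω) := fun k => Measurable.mul
    ((measurable_one.indicator ((alg.measurableSet_stopSet k).inter (mC k))).comp (measurable_info k))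
    ((measurable_likelihood mℓ k).comp (measurable_rounds k))
  rw [← lintegral_finsetSum _ fun k _ => mf k]
  refine lintegral_mono fun ω => ?_
  by_cases h : ω ∈ alg.stopEvent C n
  · have h' := h
    simp only [stopEvent, Set.mem_iUnion] at h'
    obtain ⟨k, hk, hk'⟩ := h'
    have hk'' : info k ω ∈ alg.stopSet k ∩ C k := hk'
    refine le_trans (le_of_eq ?_) (Finset.single_le_sum (fun _ _ => zero_le) hk)
    rw [Set.indicator_of_mem h, Set.indicator_of_mem hk'', likelihood_rounds_eq,
      stoppedSum_eq (Finset.mem_range.1 hk).le (Or.inl ((alg.stopTime_eq_iff k ω).2 hk''.1))]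
    rfl
  · rw [Set.indicator_of_notMem h, zero_mul]
    exact zero_le

/-- Every run either stops at one `k < n` or reaches the horizon, and the matching term carries its
likelihood. Combined with `sum_lintegral_stopSet_add_le`, this bounds by 1 the expected likelihood
ratio at the truncated stopping time. -/
theorem lintegral_exp_stoppedSum_le (hY : Measurable Y) (n : ℕ) :
    ∫⁻ ω, ENNReal.ofReal (Real.exp (-alg.stoppedSum Y n ω)) ∂alg.law M ≤
      ∑ k ∈ Finset.range n, ∫⁻ ω, (alg.stopSet k).indicator 1 (info k ω) *
        likelihood (fun e => ENNReal.ofReal (Real.exp (-Y e))) (rounds k ω) ∂alg.law M +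
      ∫⁻ ω, (alg.stopSet n ∪ alg.aliveSet n).indicator 1 (info n ω) *
        likelihood (fun e => ENNReal.ofReal (Real.exp (-Y e))) (rounds n ω) ∂alg.law M := by
  have mℓ : Measurable fun e => ENNReal.ofReal (Real.exp (-Y e)) := by fun_prop
  have mf : ∀ k, Measurable fun ω => (alg.stopSet k).indicator (1 : Info S A H k → ℝ≥0∞) (info k ω) *
      likelihood (fun e => ENNReal.ofReal (Real.exp (-Y e))) (rounds k ω) := fun k => Measurable.mul
    ((measurable_one.indicator (alg.measurableSet_stopSet k)).comp (measurable_info k))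
    ((measurable_likelihood mℓ k).comp (measurable_rounds k))
  rw [← lintegral_finsetSum _ fun k _ => mf k, ← lintegral_add_left
    (Finset.measurable_sum _ fun k _ => mf k)]
  refine lintegral_mono fun ω => ?_
  by_cases h : (n : ℕ∞) ≤ alg.stopTime ω
  · refine le_trans (le_of_eq ?_) le_add_self
    have hm : info n ω ∈ alg.stopSet n ∪ alg.aliveSet n := by
      rcases h.eq_or_lt with h | h
      · exact Or.inl ((alg.stopTime_eq_iff n ω).1 h.symm)
      · exact Or.inr ((alg.lt_stopTime_iff n ω).1 h)
    rw [Set.indicator_of_mem hm, likelihood_rounds_eq, stoppedSum_eq le_rfl (Or.inr ⟨rfl, h⟩)]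
    simp
  · have hlt := not_le.1 h
    obtain ⟨k, hk⟩ := ENat.ne_top_iff_exists.1 hlt.ne_top
    rw [← hk, Nat.cast_lt] at hlt
    refine le_trans (le_of_eq ?_) le_self_add
    rw [Finset.sum_eq_single_of_mem k (Finset.mem_range.2 hlt), Set.indicator_of_mem
      ((alg.stopTime_eq_iff k ω).1 hk.symm), likelihood_rounds_eq,
      stoppedSum_eq hlt.le (Or.inl hk.symm)]
    · simp
    · intro j _ hj
      rw [Set.indicator_of_notMem, zero_mul]
      intro hm
      have := hk.trans ((alg.stopTime_eq_iff j ω).2 hm)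
      exact hj (by exact_mod_cast this.symm)

/-- Wald's identity, as an inequality. -/
theorem integral_stoppedSum_le {κ : ℝ} (hκ : 0 ≤ κ) {v : Policy S A H → ℝ≥0∞} (mv : Measurable v)
    (hv : ∀ π, v π ≤ 1) (hY : Measurable Y) (hb : ∀ e, |Y e| ≤ b)
    (hD : ∀ π, ∫ e, Y e ∂M.episodeLaw π ≤ κ * (v π).toReal) (n : ℕ) :
    ∫ ω, alg.stoppedSum Y n ω ∂alg.law M ≤ κ * (∑ k ∈ Finset.range n,
      ∫⁻ ω in info k ⁻¹' alg.aliveSet k, v (alg.play k (info k ω)) ∂alg.law M).toReal := by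
  classical
  have hvt : ∀ k, ∫⁻ ω in info k ⁻¹' alg.aliveSet k, v (alg.play k (info k ω)) ∂alg.law M ≠ ∞ := by
    intro k
    refine ne_top_of_le_ne_top ENNReal.one_ne_top ((lintegral_mono fun ω => hv _).trans ?_)
    rw [lintegral_one, Measure.restrict_apply_univ]
    exact prob_le_one
  have mF := fun k => measurable_aliveSet_indicator alg hY k
  have mG : ∀ k, Measurable fun ω : ℕ → unitInterval × Episode S A H => (info k ω, (ω k).2) :=
    fun k => by fun_prop
  have hint : ∀ k, Integrable (fun p : Info S A H k × Episode S A H =>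
      (alg.aliveSet k).indicator (fun _ => Y p.2) p.1)
      ((alg.law M).map (fun ω => (info k ω, (ω k).2))) := by
    intro k
    have : IsProbabilityMeasure ((alg.law M).map
        (fun ω : ℕ → unitInterval × Episode S A H => (info k ω, (ω k).2))) :=
      Measure.isProbabilityMeasure_map (mG k).aemeasurable
    exact Integrable.of_bound (mF k).aestronglyMeasurable b
      (Filter.Eventually.of_forall fun p => abs_indicator_le hb k p)
  have hint2 : ∀ k, Integrable (fun ω => (alg.aliveSet k).indicator (fun _ => Y (ω k).2) (info k ω))
      (alg.law M) := fun k => (hint k).comp_measurable (mG k)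
  unfold stoppedSum
  rw [integral_finsetSum _ fun k _ => hint2 k,
    ENNReal.toReal_sum fun k _ => hvt k, Finset.mul_sum]
  refine Finset.sum_le_sum fun k _ => ?_
  have h1 : ∫ ω, (alg.aliveSet k).indicator (fun _ => Y (ω k).2) (info k ω) ∂alg.law M =
      ∫ p, (alg.aliveSet k).indicator (fun _ => Y p.2) p.1
        ∂(alg.law M).map (fun ω => (info k ω, (ω k).2)) :=
    (integral_map (mG k).aemeasurable (mF k).aestronglyMeasurable).symm
  have hint' := hint k
  rw [map_law_info_episode] at hint'
  have mvp : Measurable fun x => v (alg.play k x) := mv.comp (alg.measurable_play k)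
  have hmi : MeasurableSet (info k ⁻¹' alg.aliveSet k) :=
    measurable_info k (alg.measurableSet_aliveSet k)
  have mI : StronglyMeasurable fun x => ∫ e, (alg.aliveSet k).indicator (fun _ => Y e) x
      ∂(M.episodeKernel.comap _ (alg.measurable_play k)) x :=
    MeasureTheory.StronglyMeasurable.integral_kernel_prod_right' (mF k).stronglyMeasurable
  have mv' : Measurable fun ω => v (alg.play k (info k ω)) := mvp.comp (measurable_info k)
  rw [h1, map_law_info_episode, Measure.integral_compProd hint', integral_map
    (measurable_info k).aemeasurable mI.aestronglyMeasurable,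
    ← integral_toReal mv'.aemeasurable
      (Filter.Eventually.of_forall fun ω => (hv _).trans_lt ENNReal.one_lt_top),
    ← integral_const_mul, ← integral_indicator hmi]
  refine integral_mono ?_ ?_ fun ω => ?_
  · refine Integrable.of_bound (mI.comp_measurable (measurable_info k)).aestronglyMeasurable b
      (Filter.Eventually.of_forall fun ω => ?_)
    refine (norm_integral_le_of_norm_le_const (C := b)
      (Filter.Eventually.of_forall fun e => abs_indicator_le hb k (info k ω, e))).trans ?_
    simp
  · refine Integrable.of_bound ((mv'.ennreal_toReal.const_mul κ).indicator
      hmi).aestronglyMeasurable κ (Filter.Eventually.of_forall fun ω => ?_)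
    rw [Set.indicator_apply]
    split_ifs
    · rw [Real.norm_of_nonneg (mul_nonneg hκ ENNReal.toReal_nonneg)]
      exact mul_le_of_le_one_right hκ (ENNReal.toReal_le_of_le_ofReal zero_le_one (by simpa using hv _))
    · simpa using hκ
  · by_cases hm : info k ω ∈ alg.aliveSet k
    · have hm' : ω ∈ info k ⁻¹' alg.aliveSet k := hm
      -- Whether episode `k` is played is decided by `info k`, so given that information `hD`
      -- applies to the policy chosen.
      simp only [Set.indicator_of_mem hm, Set.indicator_of_mem hm']
      exact hD _
    · have hm' : ω ∉ info k ⁻¹' alg.aliveSet k := hm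
      simp [Set.indicator_of_notMem hm, Set.indicator_of_notMem hm']

/-- The transportation inequality, for one deterministic time horizon. -/
theorem le_integral_stoppedSum (hY : Measurable Y) (hb : ∀ e, |Y e| ≤ b) {δ : ℝ} (hδ0 : 0 < δ)
    (hδ1 : δ < 1 / 2) {C : (k : ℕ) → Set (Info S A H k)} (mC : ∀ k, MeasurableSet (C k)) (n : ℕ)
    (h1 : ∫⁻ ω, ENNReal.ofReal (Real.exp (-alg.stoppedSum Y n ω)) ∂alg.law M ≤ 1)
    (h2 : ∫⁻ ω, (alg.stopEvent C n).indicator 1 ω *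
      ENNReal.ofReal (Real.exp (-alg.stoppedSum Y n ω)) ∂alg.law M ≤ ENNReal.ofReal δ) :
    (2 * (alg.law M).real (alg.stopEvent C n) - 1) * Real.log ((1 - δ) / δ) ≤
      ∫ ω, alg.stoppedSum Y n ω ∂alg.law M := by
  classical
  set Λ := Real.log ((1 - δ) / δ) with hΛ
  set G := alg.stopEvent C n with hG
  set T := alg.stoppedSum Y n with hT
  have mG : MeasurableSet G := measurableSet_stopEvent mC n
  have mT : Measurable T := measurable_stoppedSum alg hY n
  have iT : Integrable T (alg.law M) := Integrable.of_bound mT.aestronglyMeasurable (n * b)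
    (Filter.Eventually.of_forall fun ω => abs_stoppedSum_le hb n ω)
  have mE : Measurable fun ω => Real.exp (-T ω) := by fun_prop
  have iE : Integrable (fun ω => Real.exp (-T ω)) (alg.law M) :=
    Integrable.of_bound mE.aestronglyMeasurable (Real.exp (n * b))
      (Filter.Eventually.of_forall fun ω => by
        rw [Real.norm_of_nonneg (Real.exp_pos _).le]
        exact Real.exp_le_exp.2 ((neg_le_abs _).trans (abs_stoppedSum_le hb n ω)))
  have iGE : Integrable (G.indicator fun ω => Real.exp (-T ω)) (alg.law M) := iE.indicator mG
  have i1 : Integrable (G.indicator fun _ => (1 : ℝ)) (alg.law M) :=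
    (integrable_const 1).indicator mG
  have e1 : ∫ ω, Real.exp (-T ω) ∂alg.law M ≤ 1 := by
    rw [integral_eq_lintegral_of_nonneg_ae (Filter.Eventually.of_forall fun ω => (Real.exp_pos _).le)
      mE.aestronglyMeasurable]
    exact ENNReal.toReal_le_of_le_ofReal zero_le_one (by simpa using h1)
  have e2 : ∫ ω, G.indicator (fun ω => Real.exp (-T ω)) ω ∂alg.law M ≤ δ := by
    rw [integral_eq_lintegral_of_nonneg_ae (Filter.Eventually.of_forall fun ω =>
      Set.indicator_nonneg (fun _ _ => (Real.exp_pos _).le) ω)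
      (mE.indicator mG).aestronglyMeasurable]
    refine ENNReal.toReal_le_of_le_ofReal hδ0.le (le_trans (le_of_eq ?_) h2)
    refine lintegral_congr fun ω => ?_
    by_cases h : ω ∈ G <;> simp [h]
  have e3 : ∫ ω, G.indicator (fun _ => (1 : ℝ)) ω ∂alg.law M = (alg.law M).real G := by
    rw [integral_indicator_const _ mG]; simp
  have h1δ : 0 < 1 - δ := by linarith
  set x := (1 - δ) / δ with hx
  have hx0 : 0 < x := div_pos h1δ hδ0
  have hx1 : 1 ≤ x := by rw [hx, le_div_iff₀ hδ0]; linarith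
  -- Donsker–Varadhan with a test function equal to Λ on `G` and -Λ off it: the tangent bound log y
  -- ≤ y - 1 is used at y = x exp(-T) on `G` and at y = x⁻¹ exp(-T) elsewhere.
  have hpt : ∀ ω, 2 * Λ * G.indicator (fun _ => (1 : ℝ)) ω + (1 - Λ) - x⁻¹ * Real.exp (-T ω) -
      (x - x⁻¹) * G.indicator (fun ω => Real.exp (-T ω)) ω ≤ T ω := by
    intro ω
    have l1 := Real.log_le_sub_one_of_pos (mul_pos (Real.exp_pos (-T ω)) hx0)
    have l2 := Real.log_le_sub_one_of_pos (mul_pos (Real.exp_pos (-T ω)) (inv_pos.2 hx0))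
    rw [Real.log_mul (Real.exp_pos _).ne' hx0.ne', Real.log_exp] at l1
    rw [Real.log_mul (Real.exp_pos _).ne' (inv_pos.2 hx0).ne', Real.log_exp, Real.log_inv] at l2
    by_cases h : ω ∈ G
    · simp only [Set.indicator_of_mem h]
      linarith
    · simp only [Set.indicator_of_notMem h]
      linarith
  have j1 : Integrable (fun ω => 2 * Λ * G.indicator (fun _ => (1 : ℝ)) ω) (alg.law M) :=
    i1.const_mul (2 * Λ)
  have j2 : Integrable (fun ω => 2 * Λ * G.indicator (fun _ => (1 : ℝ)) ω + (1 - Λ)) (alg.law M) :=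
    j1.add (integrable_const (1 - Λ))
  have j3 : Integrable (fun ω => x⁻¹ * Real.exp (-T ω)) (alg.law M) := iE.const_mul x⁻¹
  have j4 : Integrable (fun ω => 2 * Λ * G.indicator (fun _ => (1 : ℝ)) ω + (1 - Λ) -
      x⁻¹ * Real.exp (-T ω)) (alg.law M) := j2.sub j3
  have j5 : Integrable (fun ω => (x - x⁻¹) * G.indicator (fun ω => Real.exp (-T ω)) ω)
      (alg.law M) := iGE.const_mul (x - x⁻¹)
  have hmono := integral_mono (j4.sub j5) iT hpt
  have hcalc : ∫ ω, (2 * Λ * G.indicator (fun _ => (1 : ℝ)) ω + (1 - Λ) - x⁻¹ * Real.exp (-T ω) -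
      (x - x⁻¹) * G.indicator (fun ω => Real.exp (-T ω)) ω) ∂alg.law M =
      2 * Λ * (alg.law M).real G + (1 - Λ) - x⁻¹ * ∫ ω, Real.exp (-T ω) ∂alg.law M -
      (x - x⁻¹) * ∫ ω, G.indicator (fun ω => Real.exp (-T ω)) ω ∂alg.law M := by
    rw [integral_sub j4 j5, integral_sub j2 j3, integral_add j1 (integrable_const (1 - Λ)),
      integral_const_mul, integral_const_mul, integral_const_mul, e3]
    simp
  have hmono' := hcalc.symm.trans_le hmono
  have hxi : x⁻¹ ≤ 1 := inv_le_one_of_one_le₀ hx1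
  have p1 := mul_le_mul_of_nonneg_left e1 (inv_pos.2 hx0).le
  have p2 := mul_le_mul_of_nonneg_left e2 (by linarith : 0 ≤ x - x⁻¹)
  -- The value x = (1 - δ)/δ makes the exponential terms contribute at most 1, which cancels the
  -- constant 1.
  have p3 : x⁻¹ * 1 + (x - x⁻¹) * δ = 1 := by
    rw [hx]; field_simp; ring
  linarith

/-- The algorithm either is still running, or has stopped. -/
theorem one_le_stopEvent_add {C : (k : ℕ) → Set (Info S A H k)} {δ : ℝ≥0∞} (n : ℕ)
    (h : ∑ k ∈ Finset.range (n + 1), alg.law M (info k ⁻¹' (alg.stopSet k ∩ (C k)ᶜ)) ≤ δ) :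
    1 ≤ alg.law M (alg.stopEvent C (n + 1)) + δ + alg.law M (info n ⁻¹' alg.aliveSet n) := by
  have hU : (Set.univ : Set (ℕ → unitInterval × Episode S A H)) ⊆ alg.stopEvent C (n + 1) ∪
      (⋃ k ∈ Finset.range (n + 1), info k ⁻¹' (alg.stopSet k ∩ (C k)ᶜ)) ∪
      info n ⁻¹' alg.aliveSet n := by
    intro ω _
    by_cases hlt : (n : ℕ∞) < alg.stopTime ω
    · exact Or.inr ((alg.lt_stopTime_iff n ω).1 hlt)
    · have hlt := not_lt.1 hlt
      obtain ⟨k, hk⟩ := ENat.ne_top_iff_exists.1 (ne_top_of_le_ne_top (ENat.natCast_ne_top n) hlt)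
      rw [← hk, Nat.cast_le] at hlt
      have hs : info k ω ∈ alg.stopSet k := (alg.stopTime_eq_iff k ω).1 hk.symm
      have hkr : k ∈ Finset.range (n + 1) := Finset.mem_range.2 (by omega)
      refine Or.inl ?_
      by_cases hC : info k ω ∈ C k
      · exact Or.inl (Set.mem_biUnion hkr ⟨hs, hC⟩)
      · exact Or.inr (Set.mem_biUnion hkr ⟨hs, hC⟩)
  calc (1 : ℝ≥0∞) = alg.law M Set.univ := measure_univ.symm
    _ ≤ _ := measure_mono hU
    _ ≤ _ := measure_union_le _ _
    _ ≤ _ := by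
      gcongr
      refine (measure_union_le _ _).trans ?_
      gcongr
      exact (measure_biUnion_finset_le _ _).trans h

/-- The transportation inequality at the stopping time. -/
theorem le_mul_tsum_visits (hY : Measurable Y) (hb : ∀ e, |Y e| ≤ b) {δ : ℝ} (hδ0 : 0 < δ)
    (hδ1 : δ < 1 / 2) {C : (k : ℕ) → Set (Info S A H k)} (mC : ∀ k, MeasurableSet (C k))
    {κ : ℝ} (hκ : 0 ≤ κ) {v : Policy S A H → ℝ≥0∞} (mv : Measurable v)
    (hv : ∀ π, v π ≤ 1) (hD : ∀ π, ∫ e, Y e ∂M.episodeLaw π ≤ κ * (v π).toReal)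
    (hfin : ∑' k, alg.law M (info k ⁻¹' alg.aliveSet k) ≠ ∞)
    (h1 : ∀ n, ∫⁻ ω, ENNReal.ofReal (Real.exp (-alg.stoppedSum Y n ω)) ∂alg.law M ≤ 1)
    (h2 : ∀ n, ∫⁻ ω, (alg.stopEvent C n).indicator 1 ω *
      ENNReal.ofReal (Real.exp (-alg.stoppedSum Y n ω)) ∂alg.law M ≤ ENNReal.ofReal δ)
    (h3 : ∀ n, ∑ k ∈ Finset.range n, alg.law M (info k ⁻¹' (alg.stopSet k ∩ (C k)ᶜ)) ≤
      ENNReal.ofReal δ) :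
    (1 - 2 * δ) * Real.log ((1 - δ) / δ) ≤ κ *
      (∑' k, ∫⁻ ω in info k ⁻¹' alg.aliveSet k, v (alg.play k (info k ω)) ∂alg.law M).toReal := by
  set t : ℕ → ℝ≥0∞ := fun k =>
    ∫⁻ ω in info k ⁻¹' alg.aliveSet k, v (alg.play k (info k ω)) ∂alg.law M with ht
  have hle : ∀ k, t k ≤ alg.law M (info k ⁻¹' alg.aliveSet k) := by
    intro k
    refine (lintegral_mono fun ω => hv _).trans ?_
    rw [lintegral_one, Measure.restrict_apply_univ]
  have htop : ∑' k, t k ≠ ∞ := ne_top_of_le_ne_top hfin (ENNReal.tsum_le_tsum hle)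
  have hΛ : 0 ≤ Real.log ((1 - δ) / δ) := Real.log_nonneg (by rw [le_div_iff₀ hδ0]; linarith)
  have hn : ∀ n, (2 * (1 - δ - (alg.law M).real (info n ⁻¹' alg.aliveSet n)) - 1) *
      Real.log ((1 - δ) / δ) ≤ κ * (∑' k, t k).toReal := by
    intro n
    -- The horizon is n + 1 because `stopEvent` uses k < n + 1, the exact complement of still being
    -- alive after `n` rounds.
    have a1 := le_integral_stoppedSum hY hb hδ0 hδ1 mC (n + 1) (h1 (n + 1)) (h2 (n + 1))
    have a2 := integral_stoppedSum_le (alg := alg) hκ mv hv hY hb hD (n + 1)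
    have a3 : (∑ k ∈ Finset.range (n + 1), t k).toReal ≤ (∑' k, t k).toReal :=
      ENNReal.toReal_mono htop (ENNReal.sum_le_tsum _)
    have a4 := one_le_stopEvent_add n (h3 (n + 1))
    have a5 : 1 ≤ (alg.law M).real (alg.stopEvent C (n + 1)) + δ +
        (alg.law M).real (info n ⁻¹' alg.aliveSet n) := by
      have := ENNReal.toReal_mono (by finiteness) a4
      rwa [ENNReal.toReal_add (by finiteness) (by finiteness), ENNReal.toReal_add (by finiteness)
        (by finiteness), ENNReal.toReal_ofReal hδ0.le, ENNReal.toReal_one] at this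
    refine le_trans ?_ (a1.trans (a2.trans (mul_le_mul_of_nonneg_left a3 hκ)))
    gcongr
    linarith
  -- The survival probabilities are summable by `hfin`, so they tend to 0 and the bounds pass to the
  -- limit.
  have hlim : Filter.Tendsto (fun n => (alg.law M).real (info n ⁻¹' alg.aliveSet n))
      Filter.atTop (nhds 0) := by
    have := (ENNReal.tendsto_toReal ENNReal.zero_ne_top).comp
      (ENNReal.tendsto_atTop_zero_of_tsum_ne_top hfin)
    rw [ENNReal.toReal_zero] at this
    exact this
  have hlim2 := ((((hlim.const_sub (1 - δ)).const_mul 2).sub_const 1).mul_const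
    (Real.log ((1 - δ) / δ)))
  have := le_of_tendsto' hlim2 hn
  refine le_trans (le_of_eq ?_) this
  ring

end Algorithm

/-! ### Mistakes at possibly unreachable states -/

section Smoothing

variable {S A H : ℕ} {P0 : stdSimplex ℝ (Fin S)}
  {P : Fin H → Fin S → Fin A → stdSimplex ℝ (Fin S)}
  {μ : Fin H → Fin S → Fin A → unitInterval} {hbar : Fin H} {s : Fin S} {b : Fin A}
  {d : Fin H → Fin S → Fin A} {θ : ℝ}

theorem reach_pos_of_le {M : MDP S A H} {c : ℝ} (hA : 0 < A) (hc : 0 < c) (h0 : ∀ s, c ≤ M.P0 s)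
    (hP : ∀ h s a s', c ≤ M.P h s a s') (h : Fin H) (s : Fin S) : 0 < M.reach h s := by
  refine lt_of_lt_of_le ?_ (le_iSup _ (fun _ _ => uniformDist A hA))
  rw [MDP.visitState_eq, ENNReal.ofReal_pos]
  exact hc.trans_le (le_occ h0 hP _ h s)

/-- An algorithm that is correct on the identifiable MDPs rarely makes mistakes at `(hbar, s)`,
even if this pair cannot be reached in the MDP at hand: the mean reward `q` at `(hbar, s, b)` makes
`d` optimal. -/
theorem sum_lintegral_mistake_le (hS : 0 < S) (hA : 0 < A) {q : unitInterval}
    (hμ : IsLeveled (updateMean μ hbar s b q) hbar d θ) (hθ : 0 ≤ θ) (hθ1 : θ < 1)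
    (hp : (μ hbar s b : ℝ) ∈ Set.Ioo (0 : ℝ) 1) (hq : (q : ℝ) ∈ Set.Ioo (0 : ℝ) 1)
    {alg : Algorithm S A H} {δ : ℝ} (hδ0 : 0 ≤ δ) (hδ1 : δ ≤ 1)
    (hPAC : alg.IsPAC (identifiable S A H) 0 δ) {B : (k : ℕ) → Set (Info S A H k)}
    (mB : ∀ k, MeasurableSet (B k))
    (hB : ∀ k, ∀ x ∈ B k, alg.output k x hbar s (d hbar s) ≠ 1) (n : ℕ) :
    ∑ k ∈ Finset.range n, ∫⁻ ω, (alg.stopSet k ∩ B k).indicator 1 (Algorithm.info k ω) *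
      Algorithm.likelihood
        (fun e => ENNReal.ofReal (Real.exp (-episodeLLR hbar s b (μ hbar s b) q e)))
        (Algorithm.rounds k ω) ∂alg.law (bernoulliMDP P0 P μ) ≤ ENNReal.ofReal δ := by
  refine Algorithm.sum_lintegral_stopSet_inter_le hδ0 hδ1 (by fun_prop) mB (fun c hc => ?_) n
  have hH : (0 : ℝ) < H := by
    have := hbar.pos
    exact_mod_cast this
  have hH1 : (1 : ℝ) ≤ H := by
    have := hbar.pos
    exact_mod_cast this
  have hct : c ≠ ∞ := ne_top_of_lt hc
  have hc1 : c.toReal < 1 := by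
    have := (ENNReal.toReal_lt_toReal hct ENNReal.one_ne_top).2 hc
    simpa using this
  have hc0 : 0 ≤ c.toReal := ENNReal.toReal_nonneg
  have hε0 : 0 < (1 - c.toReal) / H := div_pos (by linarith) hH
  have hε1 : (1 - c.toReal) / H ≤ 1 := by rw [div_le_one hH]; linarith
  -- Bernoulli's inequality then gives (1 - ε)^H ≥ 1 - Hε = c.
  set ε : unitInterval := ⟨(1 - c.toReal) / H, hε0.le, hε1⟩ with hε
  have hcε : c ≤ ENNReal.ofReal ((1 - ε : ℝ) ^ H) := by
    rw [← ENNReal.ofReal_toReal hct]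
    refine ENNReal.ofReal_le_ofReal ?_
    have h1 := one_add_mul_le_pow (a := -(ε : ℝ)) (by simp only [hε]; linarith) H
    have h2 : (H : ℝ) * ((1 - c.toReal) / H) = 1 - c.toReal := by field_simp
    have h3 : 1 + (H : ℝ) * -(ε : ℝ) = c.toReal := by
      simp only [hε]; linarith
    rw [h3] at h1
    rwa [sub_eq_add_neg]
  set N := bernoulliMDP (smooth hS ε P0) (fun h s a => smooth hS ε (P h s a))
    (updateMean μ hbar s b q) with hN
  have hεS : 0 < (ε : ℝ) * (S : ℝ)⁻¹ := mul_pos hε0 (by positivity)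
  have h0 : ∀ s, (ε : ℝ) * (S : ℝ)⁻¹ ≤ N.P0 s := fun s => le_smooth hS ε _ s
  have hP : ∀ h s a s', (ε : ℝ) * (S : ℝ)⁻¹ ≤ N.P h s a s' := fun h s a s' => le_smooth hS ε _ s'
  have hg := hμ.isGreedy (P0 := smooth hS ε P0) (P := fun h s a => smooth hS ε (P h s a)) hθ hθ1
  refine ⟨N, fun π => ?_, hPAC N ⟨hμ.hasUniqueOptimalActions hθ hθ1,
    reach_pos_of_le hA hεS h0 hP⟩, fun k x hx => ?_⟩
  · refine le_trans ?_ (smul_withDensity_episodeLaw_le (P0 := P0) (P := P)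
      (pow_nonneg (sub_nonneg.2 ε.2.2) H) (pow_mul_pathProb_le hS ε P0 P) hp hq π)
    intro t
    simp only [Measure.smul_apply, smul_eq_mul]
    exact mul_le_mul_left hcε _
  · by_contra hle
    -- In the smoothed MDP the output policy does reach `s` at `hbar`, so optimality forces it to
    -- play `d hbar s` there with probability 1.
    exact hB k x hx (hg.policy_eq_one (not_lt.1 hle) (hεS.trans_le (le_occ h0 hP _ hbar s))
      fun a ha => hμ.gap_pos hθ hθ1 hbar s ha)

end Smoothing

/-! ### The hard instance and its perturbations -/

section Instance

variable {S A H : ℕ}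

/-- Mean rewards: `1` for the optimal actions `a0` and `0` for the others, except at step `hbar`,
where the optimal actions are `astar` and the gaps are `gap`. -/
noncomputable def hardMean (hbar : Fin H) (astar : Fin S → Fin A) (gap : Fin S → Fin A → ℝ)
    (a0 : Fin A) : Fin H → Fin S → Fin A → unitInterval := fun h s a =>
  if h = hbar then
    if a = astar s then ⟨1 / 2, by norm_num, by norm_num⟩
    else Set.projIcc 0 1 zero_le_one (1 / 2 - gap s a)
  else if a = a0 then 1 else 0

/-- The optimal actions for `hardMean`. -/
def hardAction (hbar : Fin H) (astar : Fin S → Fin A) (a0 : Fin A) : Fin H → Fin S → Fin A :=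
  fun h s => if h = hbar then astar s else a0

/-- The given transitions before step `hbar`, uniform ones afterwards. -/
noncomputable def hardKernel (hS : 0 < S) (hbar : Fin H)
    (P : Fin H → Fin S → Fin A → stdSimplex ℝ (Fin S)) :
    Fin H → Fin S → Fin A → stdSimplex ℝ (Fin S) :=
  fun h s a => if h < hbar then P h s a else uniformDist S hS

variable {hbar : Fin H} {astar : Fin S → Fin A} {gap : Fin S → Fin A → ℝ} {a0 : Fin A}

theorem hardMean_astar (s : Fin S) : (hardMean hbar astar gap a0 hbar s (astar s) : ℝ) = 1 / 2 := by
  simp [hardMean]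

theorem hardMean_of_ne (hgap : ∀ s a, a ≠ astar s → gap s a ∈ Set.Ioo (0 : ℝ) (1 / 2)) {s : Fin S}
    {a : Fin A} (ha : a ≠ astar s) :
    (hardMean hbar astar gap a0 hbar s a : ℝ) = 1 / 2 - gap s a := by
  obtain ⟨h1, h2⟩ := hgap s a ha
  simp only [hardMean, if_true, ha, if_false]
  rw [Set.projIcc_of_mem zero_le_one ⟨by linarith, by linarith⟩]

theorem isLeveled_hardMean (hgap : ∀ s a, a ≠ astar s → gap s a ∈ Set.Ioo (0 : ℝ) (1 / 2)) :
    IsLeveled (hardMean hbar astar gap a0) hbar (hardAction hbar astar a0) 0 where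
  best h s hh := by simp [hardMean, hardAction, hh]
  other h s a hh ha := by
    have : a ≠ a0 := by simpa [hardAction, hh] using ha
    simp [hardMean, hh, this]
  le_best s := by simp [hardAction, hardMean_astar]
  best_le s := by simp [hardAction, hardMean_astar]
  lt_best s a ha := by
    have ha : a ≠ astar s := by simpa [hardAction] using ha
    have := (hgap s a ha).1
    simp only [hardAction, if_true, hardMean_astar, hardMean_of_ne hgap ha]
    linarith

/-- The raised mean exceeds the former optimum 1/2 by gap/2: enough to make `b` uniquely best at
`s`, yet a spread below 1, so that the optimal actions at other steps survive. -/
theorem isLeveled_updateMean_hardMean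
    (hgap : ∀ s a, a ≠ astar s → gap s a ∈ Set.Ioo (0 : ℝ) (1 / 2)) {s : Fin S} {b : Fin A}
    (hb : b ≠ astar s) {q : unitInterval} (hq : (q : ℝ) = 1 / 2 + gap s b / 2) :
    IsLeveled (updateMean (hardMean hbar astar gap a0) hbar s b q) hbar
      (fun h t => if h = hbar ∧ t = s then b else hardAction hbar astar a0 h t) (gap s b / 2) := by
  have h0 := isLeveled_hardMean (hbar := hbar) (a0 := a0) hgap
  have hg := (hgap s b hb).1
  have hbest : ∀ t, t ≠ s → (hardMean hbar astar gap a0 hbar t (hardAction hbar astar a0 hbar t) : ℝ) =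
      1 / 2 := fun t _ => by simp [hardAction, hardMean_astar]
  have hle : ∀ t a, (hardMean hbar astar gap a0 hbar t a : ℝ) ≤ 1 / 2 := by
    intro t a
    by_cases ha : a = astar t
    · rw [ha, hardMean_astar]
    · rw [hardMean_of_ne hgap ha]; linarith [(hgap t a ha).1]
  constructor
  · intro h t hh
    simp only [updateMean, hh, false_and, if_false]
    exact h0.best h t hh
  · intro h t a hh ha
    simp only [updateMean, hh, false_and, if_false] at ha ⊢
    exact h0.other h t a hh ha
  · intro t
    by_cases ht : t = s
    · simp only [updateMean, ht, and_self, if_true, hq]; linarith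
    · simp only [updateMean, ht, false_and, and_false, if_false, hbest t ht]; exact le_rfl
  · intro t
    by_cases ht : t = s
    · simp only [updateMean, ht, and_self, if_true, hq]; exact le_rfl
    · simp only [updateMean, ht, false_and, and_false, if_false, hbest t ht]; linarith
  · intro t a ha
    by_cases ht : t = s
    · have ha : a ≠ b := by simpa [ht] using ha
      simp only [updateMean, ht, ha, and_self, and_false, if_true, if_false, hq]
      linarith [hle s a]
    · simp only [updateMean, ht, false_and, and_false, if_false] at ha ⊢
      exact h0.lt_best t a ha

end Instance

/-! ### The lower bound on the number of episodes -/

section LowerBound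

variable {S A H : ℕ} {P0 : stdSimplex ℝ (Fin S)}
  {P : Fin H → Fin S → Fin A → stdSimplex ℝ (Fin S)}
  {hbar : Fin H} {astar : Fin S → Fin A} {gap : Fin S → Fin A → ℝ} {a0 : Fin A}

theorem updateMean_self (μ : Fin H → Fin S → Fin A → unitInterval) (hbar : Fin H) (s : Fin S)
    (b : Fin A) : updateMean μ hbar s b (μ hbar s b) = μ := by
  funext h t a
  unfold updateMean
  split_ifs with hh
  · rw [hh.1, hh.2.1, hh.2.2]
  · rfl

theorem episodeLLR_self (hbar : Fin H) (s : Fin S) (b : Fin A) {p : ℝ}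
    (hp : p ∈ Set.Ioo (0 : ℝ) 1) (e : Episode S A H) : episodeLLR hbar s b p p e = 0 := by
  have h1 : p ≠ 0 := hp.1.ne'
  have h2 : 1 - p ≠ 0 := (sub_pos.2 hp.2).ne'
  simp [episodeLLR, bernoulliLLR, h1, h2]

/-- To identify the optimal action at `(hbar, s)`, a correct algorithm has to play every suboptimal
action there sufficiently often. -/
theorem le_mul_tsum_visits_hard (hS : 0 < S) (hA : 0 < A)
    (hgap : ∀ s a, a ≠ astar s → gap s a ∈ Set.Ioo (0 : ℝ) (1 / 2)) {s : Fin S} {b : Fin A}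
    (hb : b ≠ astar s) {δ : ℝ} (hδ0 : 0 < δ) (hδ1 : δ < 1 / 2) {alg : Algorithm S A H}
    (hPAC : alg.IsPAC (identifiable S A H) 0 δ)
    (hfin : alg.expectedEpisodes (bernoulliMDP P0 P (hardMean hbar astar gap a0)) ≠ ∞) :
    (1 - 2 * δ) * Real.log ((1 - δ) / δ) ≤ 12 * gap s b ^ 2 *
      (∑' k, ∫⁻ ω in Algorithm.info k ⁻¹' alg.aliveSet k,
        (bernoulliMDP P0 P (hardMean hbar astar gap a0)).visit
          (alg.play k (Algorithm.info k ω)) hbar s b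
        ∂alg.law (bernoulliMDP P0 P (hardMean hbar astar gap a0))).toReal := by
  set μ := hardMean hbar astar gap a0 with hμdef
  set M := bernoulliMDP P0 P μ with hM
  obtain ⟨hg0, hg1⟩ := hgap s b hb
  set g := gap s b with hg
  have hpv : (μ hbar s b : ℝ) = 1 / 2 - g := hardMean_of_ne hgap hb
  have hp : (μ hbar s b : ℝ) ∈ Set.Ioo (0 : ℝ) 1 := by
    rw [hpv]; exact ⟨by linarith, by linarith⟩
  set q : unitInterval := ⟨1 / 2 + g / 2, by linarith, by linarith⟩ with hq
  have hqv : (q : ℝ) = 1 / 2 + g / 2 := rfl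
  have hq' : (q : ℝ) ∈ Set.Ioo (0 : ℝ) 1 := by
    rw [hqv]; exact ⟨by linarith, by linarith⟩
  have hl0 : IsLeveled (updateMean μ hbar s b (μ hbar s b)) hbar (hardAction hbar astar a0) 0 := by
    rw [updateMean_self]; exact isLeveled_hardMean hgap
  have hl1 := isLeveled_updateMean_hardMean (hbar := hbar) (a0 := a0) hgap hb hqv
  set C : (k : ℕ) → Set (Info S A H k) := fun k => {x | alg.output k x hbar s (astar s) = 1} with hC
  have mC : ∀ k, MeasurableSet (C k) := by
    intro k
    refine measurableSet_eq_fun ?_ measurable_const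
    exact (measurable_pi_apply _).comp (measurable_subtype_coe.comp
      ((measurable_pi_apply s).comp ((measurable_pi_apply hbar).comp (alg.measurable_output k))))
  refine Algorithm.le_mul_tsum_visits (Y := episodeLLR hbar s b (μ hbar s b) q) (by fun_prop)
    (abs_episodeLLR_le _ _) hδ0 hδ1 mC (by positivity) (v := fun π => M.visit π hbar s b)
    (M.measurable_visit hbar s b) (fun π => prob_le_one) (fun π => ?_)
    (ne_top_of_le_ne_top hfin (alg.tsum_aliveSet_le M)) (fun n => ?_) (fun n => ?_) (fun n => ?_)
  · rw [hM, integral_episodeLLR, mul_comm]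
    refine mul_le_mul_of_nonneg_right ?_ ENNReal.toReal_nonneg
    refine (bernoulli_kl_le hp hq').trans ?_
    -- Here (p - q)² = 9g²/4 and q(1 - q) = (1 - g²)/4 ≥ 3/16 because g < 1/2; the quotient is at
    -- most 12 g².
    rw [hpv, hqv, div_le_iff₀ (by nlinarith)]
    have h1 : 0 ≤ 1 / 4 - g ^ 2 := by nlinarith
    nlinarith [mul_nonneg (sq_nonneg g) h1]
  · refine (Algorithm.lintegral_exp_stoppedSum_le (by fun_prop) n).trans
      (Algorithm.sum_lintegral_stopSet_add_le (N := bernoulliMDP P0 P (updateMean μ hbar s b q))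
        (by fun_prop) (fun π => ?_) n)
    have := smul_withDensity_episodeLaw_le (P0 := P0) (P := P) (P0' := P0) (P' := P) zero_le_one
      (fun π p => (one_mul _).le) hp hq' π
    rwa [ENNReal.ofReal_one, one_smul] at this
  · refine (Algorithm.lintegral_stopEvent_le (by fun_prop) mC n).trans
      (sum_lintegral_mistake_le hS hA hl1 (by linarith) (by linarith) hp hq' hδ0.le (by linarith)
        hPAC mC (fun k x hx h1 => ?_) n)
    have h0 : ∑ a, alg.output k x hbar s a = 1 := MDP.sum_policy _ _ _
    have hx : alg.output k x hbar s (astar s) = 1 := hx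
    simp only [and_self, if_true] at h1
    -- An output playing `astar s` with probability 1 is a mistake for the perturbed means:
    -- otherwise `astar s` and `b` would both have probability 1.
    have h2 : ∑ a ∈ {astar s, b}, alg.output k x hbar s a ≤ ∑ a, alg.output k x hbar s a :=
      Finset.sum_le_sum_of_subset_of_nonneg (Finset.subset_univ _)
        fun a _ _ => MDP.policy_nonneg _ _ _ _
    rw [Finset.sum_pair hb.symm, h0, h1, hx] at h2
    norm_num at h2
  -- The instance itself may lie outside the class, so its error bound also goes through smoothing,
  -- with q = p and hence likelihood ratio 1.
  · have h1 := sum_lintegral_mistake_le (P0 := P0) (P := P) hS hA hl0 le_rfl zero_lt_one hp hp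
      hδ0.le (by linarith) hPAC (fun k => (mC k).compl) (fun k x hx h => hx (by
        simpa [hC, hardAction] using h)) n
    refine le_trans (le_of_eq ?_) h1
    refine Finset.sum_congr rfl fun k _ => ?_
    have hm : MeasurableSet (Algorithm.info k ⁻¹' (alg.stopSet k ∩ (C k)ᶜ)) :=
      Algorithm.measurable_info k ((alg.measurableSet_stopSet k).inter (mC k).compl)
    rw [← lintegral_indicator_one hm]
    refine lintegral_congr fun ω => ?_
    simp only [Algorithm.likelihood, episodeLLR_self hbar s b hp]
    simp
    rfl

/-- For δ < 1/2.4 one has 1 - 2δ > 1/6 and 1 - δ > 1/2.4. -/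
theorem log_le_mul_of_lt {δ : ℝ} (hδ0 : 0 < δ) (hδ1 : δ < 1 / 2.4) :
    Real.log (1 / (2.4 * δ)) ≤ 6 * ((1 - 2 * δ) * Real.log ((1 - δ) / δ)) := by
  have h1 : δ * 2.4 < 1 := by rwa [lt_div_iff₀ (by norm_num)] at hδ1
  have h2 : Real.log (1 / (2.4 * δ)) ≤ Real.log ((1 - δ) / δ) := by
    refine Real.log_le_log (by positivity) ?_
    rw [div_le_div_iff₀ (by positivity) hδ0]
    nlinarith
  have h3 : 0 ≤ Real.log ((1 - δ) / δ) := Real.log_nonneg (by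
    rw [le_div_iff₀ hδ0]; linarith)
  nlinarith

/-- The lower bound on the expected number of episodes. -/
theorem levelComplexity_mul_log_le (hS : 0 < S) (hA : 1 < A)
    (hgap : ∀ s a, a ≠ astar s → gap s a ∈ Set.Ioo (0 : ℝ) (1 / 2)) {δ : ℝ} (hδ0 : 0 < δ)
    (hδ1 : δ < 1 / 2.4) {alg : Algorithm S A H} (hPAC : alg.IsPAC (identifiable S A H) 0 δ) :
    (bernoulliMDP P0 P (hardMean hbar astar gap a0)).levelComplexity hbar *
      ENNReal.ofReal (Real.log (1 / (2.4 * δ))) ≤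
        72 * alg.expectedEpisodes (bernoulliMDP P0 P (hardMean hbar astar gap a0)) := by
  set M := bernoulliMDP P0 P (hardMean hbar astar gap a0) with hM
  by_cases hfin : alg.expectedEpisodes M = ∞
  · rw [hfin, ENNReal.mul_top (by norm_num)]; exact le_top
  have hlog : 0 < Real.log (1 / (2.4 * δ)) := Real.log_pos (by
    rw [lt_div_iff₀ (by norm_num)] at hδ1
    rw [lt_div_iff₀ (by positivity)]
    linarith)
  set l := ENNReal.ofReal (Real.log (1 / (2.4 * δ))) with hl
  have hl0 : l ≠ 0 := (ENNReal.ofReal_pos.2 hlog).ne'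
  -- The occupation measure of the policies played before stopping: its mass is at most the expected
  -- number of episodes, and integrating `visit` against it gives the expected number of visits.
  set ν₀ : Measure (Policy S A H) := Measure.sum fun k =>
    ((alg.law M).restrict (Algorithm.info k ⁻¹' alg.aliveSet k)).map
      fun ω => alg.play k (Algorithm.info k ω) with hν₀
  have mplay : ∀ k, Measurable fun ω => alg.play k (Algorithm.info k ω) := fun k =>
    (alg.measurable_play k).comp (Algorithm.measurable_info k)
  have hνu : ν₀ Set.univ = ∑' k, alg.law M (Algorithm.info k ⁻¹' alg.aliveSet k) := by
    rw [hν₀, Measure.sum_apply _ MeasurableSet.univ]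
    refine tsum_congr fun k => ?_
    rw [Measure.map_apply (mplay k) MeasurableSet.univ, Set.preimage_univ,
      Measure.restrict_apply_univ]
  have hνle : ν₀ Set.univ ≤ alg.expectedEpisodes M := hνu.trans_le (alg.tsum_aliveSet_le M)
  have hνtop : ν₀ Set.univ ≠ ∞ := ne_top_of_le_ne_top hfin hνle
  have hvisit : ∀ s a, ∫⁻ π, M.visit π hbar s a ∂ν₀ =
      ∑' k, ∫⁻ ω in Algorithm.info k ⁻¹' alg.aliveSet k,
        M.visit (alg.play k (Algorithm.info k ω)) hbar s a ∂alg.law M := by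
    intro s a
    rw [hν₀, lintegral_sum_measure]
    exact tsum_congr fun k => lintegral_map (M.measurable_visit hbar s a) (mplay k)
  have hvle : ∀ s a, ∫⁻ π, M.visit π hbar s a ∂ν₀ ≤ ν₀ Set.univ := fun s a =>
    (lintegral_mono fun π => (prob_le_one : M.visit π hbar s a ≤ 1)).trans (by simp)
  -- 72 = 6 · 12, from `log_le_mul_of_lt` and the divergence bound.
  have hkey : ∀ s b, b ≠ astar s → l ≤ 72 * ENNReal.ofReal (gap s b ^ 2) *
      ∫⁻ π, M.visit π hbar s b ∂ν₀ := by
    intro s b hb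
    have h1 := le_mul_tsum_visits_hard (P0 := P0) (P := P) (hbar := hbar) (a0 := a0) hS (by omega)
      hgap hb hδ0 (hδ1.trans (by norm_num)) hPAC hfin
    rw [← hvisit] at h1
    have h2 := log_le_mul_of_lt hδ0 hδ1
    have h3 : Real.log (1 / (2.4 * δ)) ≤
        72 * gap s b ^ 2 * (∫⁻ π, M.visit π hbar s b ∂ν₀).toReal := by linarith
    refine (ENNReal.ofReal_le_ofReal h3).trans (le_of_eq ?_)
    rw [ENNReal.ofReal_mul (by positivity), ENNReal.ofReal_mul (by norm_num),
      ENNReal.ofReal_toReal (ne_top_of_le_ne_top hνtop (hvle s b))]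
    norm_num
  -- The mass must be nonzero for normalization. With A > 1 there is a suboptimal action, and `hkey`
  -- forces a positive number of visits to it.
  have hν0 : ν₀ Set.univ ≠ 0 := by
    intro h0
    obtain ⟨b, hb⟩ : ∃ b, b ≠ astar ⟨0, hS⟩ := by
      have : Nontrivial (Fin A) := Fin.nontrivial_iff_two_le.2 hA
      exact exists_ne _
    have h1 := hkey ⟨0, hS⟩ b hb
    have h2 := hvle ⟨0, hS⟩ b
    rw [h0, nonpos_iff_eq_zero] at h2
    rw [h2, mul_zero, nonpos_iff_eq_zero] at h1
    exact hl0 h1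
  have : IsProbabilityMeasure ((ν₀ Set.univ)⁻¹ • ν₀) := ⟨by
    rw [Measure.smul_apply, smul_eq_mul, ENNReal.inv_mul_cancel hν0 hνtop]⟩
  obtain ⟨π', hπ'⟩ := MDP.exists_policy_visit_eq_lintegral (by omega) M ((ν₀ Set.univ)⁻¹ • ν₀)
  have hbound : M.levelComplexity hbar ≤ 72 * ν₀ Set.univ / l := by
    refine (iInf_le _ π').trans (iSup_le fun s => iSup_le fun b => iSup_le fun hpos => ?_)
    have hgapM := (isLeveled_hardMean (hbar := hbar) (a0 := a0) hgap).gap_hbar (P0 := P0) (P := P)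
      le_rfl zero_lt_one s b
    have hb : b ≠ astar s := by
      rintro rfl
      rw [hgapM] at hpos
      simp [hardAction] at hpos
    have hg : M.gap hbar s b = gap s b := by
      rw [hM, hgapM, hardMean_of_ne hgap hb]
      simp [hardAction, hardMean_astar]
    have h1 := hkey s b hb
    have h2 : ∫⁻ π, M.visit π hbar s b ∂ν₀ = M.visit π' hbar s b * ν₀ Set.univ := by
      rw [hπ', lintegral_smul_measure, smul_eq_mul, mul_comm, ← mul_assoc,
        ENNReal.mul_inv_cancel hν0 hνtop, one_mul]
    rw [h2] at h1
    have h3 : l ≤ M.visit π' hbar s b * ENNReal.ofReal (gap s b ^ 2) * (72 * ν₀ Set.univ) :=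
      h1.trans (le_of_eq (by ring))
    rw [hg]
    have hw0 : M.visit π' hbar s b * ENNReal.ofReal (gap s b ^ 2) ≠ 0 := by
      intro h0
      rw [h0, zero_mul, nonpos_iff_eq_zero] at h3
      exact hl0 h3
    have hwt : M.visit π' hbar s b * ENNReal.ofReal (gap s b ^ 2) ≠ ∞ :=
      ENNReal.mul_ne_top (ne_top_of_le_ne_top ENNReal.one_ne_top prob_le_one) ENNReal.ofReal_ne_top
    rw [ENNReal.le_div_iff_mul_le (Or.inl hl0) (Or.inl ENNReal.ofReal_ne_top),
      ENNReal.inv_mul_le_iff hw0 hwt]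
    exact h3
  rw [ENNReal.le_div_iff_mul_le (Or.inl hl0) (Or.inl ENNReal.ofReal_ne_top)] at hbound
  exact hbound.trans (mul_le_mul_right hνle _)

end LowerBound

/-! ### The upper bound on the complexity -/

section Complexity

variable {S A H : ℕ} {P0 : stdSimplex ℝ (Fin S)}
  {P : Fin H → Fin S → Fin A → stdSimplex ℝ (Fin S)}
  {μ : Fin H → Fin S → Fin A → unitInterval} {hbar : Fin H} {d : Fin H → Fin S → Fin A}

/-- Lets the reachability-free bound for the steps after `hbar` be absorbed into the reachability
term. -/
theorem one_le_iSup_inv_reach (hS : 0 < S) (M : MDP S A H) (hbar : Fin H) :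
    1 ≤ ⨆ (h : Fin H) (_ : h ≤ hbar) (s : Fin S), (M.reach h s)⁻¹ := by
  refine le_trans ?_ (le_iSup₂_of_le hbar le_rfl
    (le_iSup (fun s => (M.reach hbar s)⁻¹) (⟨0, hS⟩ : Fin S)))
  rw [ENNReal.one_le_inv]
  exact iSup_le fun π => M.visitState_le_one π _ _

/-- After step `hbar`, where the transitions are uniform, exploration is easy. -/
theorem levelComplexity_le_of_lt (hS : 0 < S) (hA : 0 < A)
    (hμ : IsLeveled μ hbar d 0) {h : Fin H} (hh : hbar < h) :
    (bernoulliMDP P0 (hardKernel hS hbar P) μ).levelComplexity h ≤ S * A := by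
  have hSR : (0 : ℝ) < S := by exact_mod_cast hS
  have hAR : (0 : ℝ) < A := by exact_mod_cast hA
  refine MDP.levelComplexity_le_of_inv_le_visit (π := fun _ _ => uniformDist A hA)
    (fun s a => ?_) (fun s a hg => ?_)
  · obtain ⟨n, hn⟩ : ∃ n, h.val = n + 1 := ⟨h.val - 1, by
      have : hbar.val < h.val := hh
      omega⟩
    have hnH : n < H := by have := h.isLt; omega
    have hocc : MDP.occ P0 (hardKernel hS hbar P) (fun _ _ => uniformDist A hA) h s = (S : ℝ)⁻¹ := by
      have e := MDP.occ_succ P0 (hardKernel hS hbar P) (fun _ _ => uniformDist A hA) ⟨n, hnH⟩ s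
      have hk : ∀ t a, hardKernel hS hbar P ⟨n, hnH⟩ t a = uniformDist S hS := fun t a => by
        unfold hardKernel
        rw [if_neg]
        have : hbar.val < h.val := hh
        intro hlt
        have : n < hbar.val := hlt
        omega
      have h1 := MDP.sum_occ P0 (hardKernel hS hbar P) (fun _ _ => uniformDist A hA) n hnH.le
      have h2 : ∀ t, ∑ a, MDP.occ P0 (hardKernel hS hbar P) (fun _ _ => uniformDist A hA) n t *
          uniformDist A hA a * (S : ℝ)⁻¹ =
          MDP.occ P0 (hardKernel hS hbar P) (fun _ _ => uniformDist A hA) n t * (S : ℝ)⁻¹ := by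
        intro t
        have hu : ∑ a, uniformDist A hA a = 1 := (uniformDist A hA).2.2
        rw [← Finset.sum_mul, ← Finset.mul_sum, hu, mul_one]
      rw [hn]
      refine e.trans ?_
      simp_rw [hk, uniformDist_apply hS, h2]
      rw [← Finset.sum_mul, h1, one_mul]
    rw [MDP.visit_eq]
    change _ ≤ ENNReal.ofReal (MDP.occ P0 (hardKernel hS hbar P) _ h s * _)
    rw [hocc, uniformDist_apply, ENNReal.ofReal_mul (by positivity),
      ENNReal.ofReal_inv_of_pos hSR, ENNReal.ofReal_inv_of_pos hAR, ENNReal.ofReal_natCast,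
      ENNReal.ofReal_natCast, ENNReal.mul_inv (Or.inr (ENNReal.natCast_ne_top A))
        (Or.inl (ENNReal.natCast_ne_top S))]
  · have ha : a ≠ d h s := by
      rintro rfl
      rw [hμ.gap_self le_rfl zero_lt_one] at hg
      exact lt_irrefl _ hg
    simpa using hμ.le_gap (P0 := P0) (P := hardKernel hS hbar P) le_rfl zero_lt_one hh.ne' s ha

/-- Each level other than `hbar` costs at most SA times the reachability supremum: by mixing
explorers before `hbar`, by uniform transitions after it. There are at most H such levels. -/
theorem bestPolicyComplexity_le (hS : 0 < S) (hA : 0 < A) (hμ : IsLeveled μ hbar d 0) :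
    (bernoulliMDP P0 (hardKernel hS hbar P) μ).bestPolicyComplexity ≤
      (bernoulliMDP P0 (hardKernel hS hbar P) μ).levelComplexity hbar +
        S * A * H * ⨆ (h : Fin H) (_ : h ≤ hbar) (s : Fin S),
          ((bernoulliMDP P0 (hardKernel hS hbar P) μ).reach h s)⁻¹ := by
  set M := bernoulliMDP P0 (hardKernel hS hbar P) μ with hM
  set X := ⨆ (h : Fin H) (_ : h ≤ hbar) (s : Fin S), (M.reach h s)⁻¹ with hX
  have hX1 : 1 ≤ X := one_le_iSup_inv_reach hS M hbar
  have hlev : ∀ h, h ≠ hbar → M.levelComplexity h ≤ S * A * X := by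
    intro h hh
    rcases lt_or_gt_of_ne hh with hlt | hlt
    · refine (M.levelComplexity_le_iSup_reach hS hA h fun s a hg => ?_).trans
        (mul_le_mul_right (le_iSup₂ (f := fun h (_ : h ≤ hbar) => ⨆ s, (M.reach h s)⁻¹) h hlt.le) _)
      have ha : a ≠ d h s := by
        rintro rfl
        rw [hM, hμ.gap_self le_rfl zero_lt_one] at hg
        exact lt_irrefl _ hg
      simpa using hμ.le_gap (P0 := P0) (P := hardKernel hS hbar P) le_rfl zero_lt_one hh s ha
    · refine (levelComplexity_le_of_lt hS hA hμ hlt).trans ?_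
      calc (S * A : ℝ≥0∞) = S * A * 1 := (mul_one _).symm
        _ ≤ _ := mul_le_mul_right hX1 _
  unfold MDP.bestPolicyComplexity
  rw [← Finset.add_sum_erase _ _ (Finset.mem_univ hbar)]
  refine add_le_add_right ?_ _
  refine (Finset.sum_le_card_nsmul _ _ (S * A * X) fun h hh =>
    hlev h (Finset.ne_of_mem_erase hh)).trans ?_
  rw [nsmul_eq_mul]
  calc ((Finset.univ.erase hbar).card : ℝ≥0∞) * (S * A * X) ≤ H * (S * A * X) := by
        refine mul_le_mul_left ?_ _
        have : (Finset.univ.erase hbar).card ≤ H := by simp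
        exact_mod_cast this
    _ = _ := by ring

end Complexity

end TabularRL

/-! ### Assembly of the proposition -/

theorem proposition2 :
    ∃ c : ℝ, 0 < c ∧ ∀ (S A H : ℕ), 1 < S → 1 < A → 1 < H →
      ∀ (hbar : Fin H) (P0 : stdSimplex ℝ (Fin S))
        (P : Fin H → Fin S → Fin A → stdSimplex ℝ (Fin S))
        (astar : Fin S → Fin A) (gap : Fin S → Fin A → ℝ),
        (∀ s a, a ≠ astar s → gap s a ∈ Set.Ioo (0 : ℝ) (1 / 2)) →
        ∃ M : TabularRL.MDP S A H,
          M.P0 = P0 ∧ (∀ h, h < hbar → M.P h = P h) ∧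
          (∃ πstar : Fin H → Fin S → Fin A,
            (∀ h s, M.gap h s (πstar h s) = 0) ∧
            (∀ s, πstar hbar s = astar s) ∧
            (∀ s a, a ≠ πstar hbar s → M.gap hbar s a = gap s a) ∧
            (∀ h s a, h ≠ hbar → a ≠ πstar h s → 1 ≤ M.gap h s a)) ∧
          (∀ δ : ℝ, 0 < δ → δ < 1 → ∀ alg : TabularRL.Algorithm S A H,
            alg.IsPAC (TabularRL.identifiable S A H) 0 δ →
            ENNReal.ofReal c * M.levelComplexity hbar *
                ENNReal.ofReal (Real.logb 2 (1 / (2.4 * δ))) ≤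
              alg.expectedEpisodes M) ∧
          M.bestPolicyComplexity ≤ M.levelComplexity hbar +
            (S * A * H : ENNReal) * ⨆ (h : Fin H) (_ : h ≤ hbar) (s : Fin S), (M.reach h s)⁻¹ := by
  have hlog2 : 0 < Real.log 2 := Real.log_pos (by norm_num)
  -- 72 is the constant of `levelComplexity_mul_log_le`; the factor log 2 converts the natural
  -- logarithm to base 2.
  refine ⟨Real.log 2 / 72, by positivity, fun S A H hS hA _ hbar P0 P astar gap hgap => ?_⟩
  have hS0 : 0 < S := by omega
  have hA0 : 0 < A := by omega
  have hμ := TabularRL.isLeveled_hardMean (hbar := hbar) (a0 := (⟨0, hA0⟩ : Fin A)) hgap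
  refine ⟨TabularRL.bernoulliMDP P0 (TabularRL.hardKernel hS0 hbar P)
    (TabularRL.hardMean hbar astar gap ⟨0, hA0⟩), rfl, fun h hh => ?_,
    ⟨TabularRL.hardAction hbar astar ⟨0, hA0⟩, hμ.gap_self le_rfl zero_lt_one,
      fun s => by simp [TabularRL.hardAction], fun s a ha => ?_, fun h s a hh ha => ?_⟩,
    fun δ hδ0 _ alg hPAC => ?_, TabularRL.bestPolicyComplexity_le hS0 hA0 hμ⟩
  · funext s a
    simp [TabularRL.bernoulliMDP, TabularRL.hardKernel, hh]
  · have ha : a ≠ astar s := by simpa [TabularRL.hardAction] using ha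
    rw [hμ.gap_hbar le_rfl zero_lt_one, TabularRL.hardMean_of_ne hgap ha]
    simp [TabularRL.hardAction, TabularRL.hardMean_astar]
  · simpa using hμ.le_gap (P0 := P0) (P := TabularRL.hardKernel hS0 hbar P) le_rfl zero_lt_one hh s ha
  · rcases lt_or_ge δ (1 / 2.4) with hδ1 | hδ1
    · have h1 := TabularRL.levelComplexity_mul_log_le (P0 := P0)
        (P := TabularRL.hardKernel hS0 hbar P) (hbar := hbar) (a0 := (⟨0, hA0⟩ : Fin A))
        hS0 hA hgap hδ0 hδ1 hPAC
      have h2 : ENNReal.ofReal (Real.log 2 / 72) *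
          ENNReal.ofReal (Real.logb 2 (1 / (2.4 * δ))) =
          (72 : ENNReal)⁻¹ * ENNReal.ofReal (Real.log (1 / (2.4 * δ))) := by
        have h3 : (72 : ENNReal)⁻¹ = ENNReal.ofReal (72 : ℝ)⁻¹ := by
          rw [ENNReal.ofReal_inv_of_pos (by norm_num)]
          norm_num
        rw [h3, ← ENNReal.ofReal_mul (by positivity), ← ENNReal.ofReal_mul (by norm_num),
          Real.logb]
        congr 1
        field_simp
      rw [mul_right_comm, h2, mul_right_comm, mul_assoc, ENNReal.inv_mul_le_iff (by norm_num)
        (by norm_num)]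
      exact h1
    -- For δ ≥ 1/2.4 the logarithm is nonpositive, `ENNReal.ofReal` sends it to 0, and the product
    -- vanishes even if the complexity is infinite.
    · have h1 : Real.logb 2 (1 / (2.4 * δ)) ≤ 0 := by
        refine Real.logb_nonpos (by norm_num) (by positivity) ?_
        rw [div_le_one (by positivity)]
        rw [div_le_iff₀ (by norm_num)] at hδ1
        linarith
      rw [ENNReal.ofReal_of_nonpos h1, mul_zero]
      exact zero_le
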